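/- For a ball $B_{r_0}\subset\mathbb R^N$ of radius $r_0>0$ about the origin, constants $\sigma,\tau>0$ and $k>0$, a pair $(v,w)\neq(0,0)$ of functions in $C^2(B_{r_0})\cap C^1(\overline{B_{r_0}})$ with $$\nabla\cdot(\sigma\nabla w)+k^2\tau w=0,\quad \Delta v+k^2v=0\ \text{ in }B_{r_0},\qquad w=v,\quad \sigma\,\partial_\nu w=\partial_\nu v\ \text{ on }\partial B_{r_0}$$ is called a pair of transmission eigenfunctions, and $k$ is then called a transmission eigenvalue for $(\sigma,\tau)$. A sequence $(\psi_m)$ of nonzero functions in $L^2(B_{r_0})$ is called surface-localized if $\|\psi_m\|_{L^2(B_\varepsilon)}/\|\psi_m\|_{L^2(B_{r_0})}\to0$ as $m\to\infty$ for every $\varepsilon>0$, where $B_\varepsilon=\{x\in B_{r_0}:\operatorname{dist}(x,\partial B_{r_0})\ge\varepsilon\}$. Let $J_\nu$ be the Bessel function of the first kind, $j_{\nu,s}$ its $s$-th positive zero, $j_m(x)=\sqrt{\pi/(2x)}\,J_{m+1/2}(x)$ the spherical Bessel function, and $Y_m^l$ the normalized spherical harmonics. Lemma. Let $k>0$, $r_0>0$,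 let $s_0\ge1$ be an integer, and let $\sigma_m>0$ ($m=0,1,2,\dots$) be given constants. (a) $N=2$. One has $J_m(kr_0)\ne0$ whenever $m\ge kr_0$. There are constants $\tau_m>0$ such that, with $n_m=\sqrt{\tau_m/\sigma_m}$, for every $m$ with $J_m(kr_0)\neq0$ $$n_m\in\Big(\frac{j_{m,s_0}}{kr_0},\frac{j_{m,s_0+1}}{kr_0}\Big)$$ and $k$ is a transmission eigenvalue of $B_{r_0}$ for $(\sigma_m,\tau_m)$. Moreover, for all nonzero constants $\beta_m\in\mathbb C$ there are nonzero constants $\alpha_m\in\mathbb C$ such that, in polar coordinates, the functions $$v_m=\beta_mJ_m(kr)e^{\mathrm im\theta},\qquad w_m=\alpha_mJ_m(kn_mr)e^{\mathrm im\theta}$$ are a pair of transmission eigenfunctions for $(\sigma_m,\tau_m)$ and $k$, for every $m$ with $J_m(kr_0)\ne0$, and the sequences $(v_m)$ and $(w_m)$ are both surface-localized. (b) $N=3$. One has $J_{m+1/2}(kr_0)\ne0$ whenever $m+\frac12\ge kr_0$. There are constants $\tau_m>0$ such that, with $n_m=\sqrt{\tau_m/\sigma_m}$, for every $m$ with $J_{m+1/2}(kr_0)\neq0$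 $$n_m\in\Big(\frac{j_{m+1/2,s_0}}{kr_0},\frac{j_{m+1/2,s_0+1}}{kr_0}\Big)$$ and $k$ is a transmission eigenvalue of $B_{r_0}$ for $(\sigma_m,\tau_m)$. Moreover, for all nonzero constants $\beta_m^l\in\mathbb C$ there are nonzero constants $\alpha_m^l\in\mathbb C$ such that, in spherical coordinates, the functions $$v_m^l=\beta_m^l\,j_m(kr)Y_m^l(\theta,\varphi),\qquad w_m^l=\alpha_m^l\,j_m(kn_mr)Y_m^l(\theta,\varphi),\qquad -m\le l\le m,$$ are a pair of transmission eigenfunctions for $(\sigma_m,\tau_m)$ and $k$, for every $m$ with $J_{m+1/2}(kr_0)\ne0$, and for every choice of $l_m$ with $|l_m|\le m$ the sequences $(v_m^{l_m})$ and $(w_m^{l_m})$ are both surface-localized. -/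

import Mathlib

open MeasureTheory Filter Topology Metric

noncomputable section

namespace TransmissionModes

/-! ### Bessel functions and their positive zeros -/

/-- The Bessel function of the first kind `J_ν(x)`, for a real order `ν ≥ 0` and `x ≥ 0`:
`J_ν(x) = (x/2)^ν ∑_p (-1)^p / (p! Γ(p+ν+1)) (x/2)^(2p)`. -/
def besselJ (ν x : ℝ) : ℝ :=
  (x / 2) ^ ν * ∑' p : ℕ,
    (-1 : ℝ) ^ p / ((p.factorial : ℝ) * Real.Gamma ((p : ℝ) + ν + 1)) * (x / 2) ^ (2 * p)

/-- The spherical Bessel function `j_m(x)`, given by its (everywhere convergent) power series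
`j_m(x) = (√π/2) (x/2)^m ∑_p (-1)^p / (p! Γ(p+m+3/2)) (x/2)^(2p)`.
For `x > 0` this is `√(π/(2x)) J_{m+1/2}(x)`; the series also gives the right value at `x = 0`. -/
def sphericalBesselJ (m : ℕ) (x : ℝ) : ℝ :=
  √Real.pi / 2 * (x / 2) ^ m * ∑' p : ℕ,
    (-1 : ℝ) ^ p / ((p.factorial : ℝ) * Real.Gamma ((p : ℝ) + ((m : ℝ) + 1 / 2) + 1)) *
      (x / 2) ^ (2 * p)

theorem sphericalBesselJ_eq (m : ℕ) {x : ℝ} (hx : 0 < x) :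
    sphericalBesselJ m x = √(Real.pi / (2 * x)) * besselJ ((m : ℝ) + 1 / 2) x := by
  unfold sphericalBesselJ besselJ
  have hx2 : 0 < x / 2 := by positivity
  rw [Real.rpow_add hx2, Real.rpow_natCast, ← Real.sqrt_eq_rpow, ← mul_assoc]
  congr 1
  have h : √(Real.pi / (2 * x)) * √(x / 2) = √Real.pi / 2 := by
    rw [← Real.sqrt_mul (by positivity)]
    have e : Real.pi / (2 * x) * (x / 2) = Real.pi / 2 ^ 2 := by field_simp
    rw [e, Real.sqrt_div (by positivity), Real.sqrt_sq (by norm_num)]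
  rw [← h]
  ring

/-- `besselZero ν s` is, for `s ≥ 1`, the `s`-th positive zero `j_{ν,s}` of `J_ν` in increasing
order: starting from the convention `j_{ν,0} = 0`, each `j_{ν,s+1}` is the least zero of `J_ν`
beyond `j_{ν,s}`. -/
def besselZero (ν : ℝ) : ℕ → ℝ
  | 0 => 0
  | s + 1 => sInf {x : ℝ | besselZero ν s < x ∧ besselJ ν x = 0}

/-! ### Spherical harmonics -/

/-- The Legendre polynomial `P_m`, by Rodrigues' formula. -/
def legendreP (m : ℕ) : Polynomial ℝ :=
  Polynomial.C (1 / (2 ^ m * (m.factorial : ℝ))) *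
    (Polynomial.derivative^[m]) ((Polynomial.X ^ 2 - 1) ^ m)

/-- The associated Legendre function `P_m^l(t) = (1 - t²)^(l/2) (d/dt)^l P_m(t)`, `-1 ≤ t ≤ 1`. -/
def assocLegendre (m l : ℕ) (t : ℝ) : ℝ :=
  √(1 - t ^ 2) ^ l * ((Polynomial.derivative^[l]) (legendreP m)).eval t

/-- The `L²(S²)`-normalized spherical harmonic
`Y_m^l(θ,φ) = √((2m+1)/(4π) · (m-|l|)!/(m+|l|)!) P_m^{|l|}(cos θ) e^{ilφ}`, for `-m ≤ l ≤ m`. -/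
def sphericalY (m : ℕ) (l : ℤ) (θ φ : ℝ) : ℂ :=
  ((√((2 * (m : ℝ) + 1) / (4 * Real.pi) *
      (((m - l.natAbs).factorial : ℝ) / ((m + l.natAbs).factorial : ℝ))) *
    assocLegendre m l.natAbs (Real.cos θ) : ℝ) : ℂ) *
    Complex.exp (Complex.I * (l : ℂ) * (φ : ℂ))

/-! ### The separated solutions -/

/-- The function `J_m(κ r) e^{imθ}` on the plane, where `(r, θ)` are the polar coordinates of `x`
(the value at the origin does not depend on the choice of `θ` there). -/
def planarMode (m : ℕ) (κ : ℝ) (x : EuclideanSpace ℝ (Fin 2)) : ℂ :=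
  (besselJ (m : ℝ) (κ * ‖x‖) : ℂ) *
    Complex.exp (Complex.I * (m : ℂ) * (Complex.arg ⟨x 0, x 1⟩ : ℂ))

/-- The function `j_m(κ r) Y_m^l(θ, φ)` on the space, where `(r, θ, φ)` are the spherical
coordinates of `x`, i.e. `x = (r sin θ cos φ, r sin θ sin φ, r cos θ)` (the values on the polar
axis do not depend on the choice of the angles there). -/
def spatialMode (m : ℕ) (l : ℤ) (κ : ℝ) (x : EuclideanSpace ℝ (Fin 3)) : ℂ :=
  (sphericalBesselJ m (κ * ‖x‖) : ℂ) *
    sphericalY m l (Real.arccos (x 2 / ‖x‖)) (Complex.arg ⟨x 0, x 1⟩)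

/-! ### The transmission eigenvalue problem on a centred ball -/

/-- `∇ · (σ ∇ w)` at the point `x`. -/
def divGrad {N : ℕ} (σ : EuclideanSpace ℝ (Fin N) → ℝ) (w : EuclideanSpace ℝ (Fin N) → ℂ)
    (x : EuclideanSpace ℝ (Fin N)) : ℂ :=
  ∑ i : Fin N,
    fderiv ℝ (fun y => (σ y : ℂ) * fderiv ℝ w y (EuclideanSpace.single i 1)) x
      (EuclideanSpace.single i 1)

/-- The (one-sided) derivative of `w` at the point `x` of the sphere of radius `r₀` in the
direction of the exterior unit normal `ν(x) = x / r₀` of the ball. -/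
def normalDeriv {N : ℕ} (r₀ : ℝ) (w : EuclideanSpace ℝ (Fin N) → ℂ)
    (x : EuclideanSpace ℝ (Fin N)) : ℂ :=
  fderivWithin ℝ w (closedBall 0 r₀) x (r₀⁻¹ • x)

/-- `(v, w)` is a pair of transmission eigenfunctions on the ball `B` of radius `r₀` about the
origin, for the material parameters `σ, τ` and the wavenumber `k`: a nontrivial pair of functions
in `C²(B) ∩ C¹(closure B)` (in particular in `H¹(B)`) that solves
`∇·(σ∇w) + k²τw = 0` and `Δv + k²v = 0` in `B`, with `w = v` and `σ ∂w/∂ν = ∂v/∂ν` on `∂B`. -/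
structure IsTransmissionEigenpair {N : ℕ} (r₀ : ℝ) (σ τ : EuclideanSpace ℝ (Fin N) → ℝ) (k : ℝ)
    (v w : EuclideanSpace ℝ (Fin N) → ℂ) : Prop where
  v_interior : ContDiffOn ℝ 2 v (ball 0 r₀)
  w_interior : ContDiffOn ℝ 2 w (ball 0 r₀)
  v_closure : ContDiffOn ℝ 1 v (closedBall 0 r₀)
  w_closure : ContDiffOn ℝ 1 w (closedBall 0 r₀)
  w_eq : ∀ x ∈ ball (0 : EuclideanSpace ℝ (Fin N)) r₀,
    divGrad σ w x + (k : ℂ) ^ 2 * (τ x : ℂ) * w x = 0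
  v_eq : ∀ x ∈ ball (0 : EuclideanSpace ℝ (Fin N)) r₀,
    Laplacian.laplacian v x + (k : ℂ) ^ 2 * v x = 0
  dirichlet : ∀ x ∈ sphere (0 : EuclideanSpace ℝ (Fin N)) r₀, w x = v x
  neumann : ∀ x ∈ sphere (0 : EuclideanSpace ℝ (Fin N)) r₀,
    (σ x : ℂ) * normalDeriv r₀ w x = normalDeriv r₀ v x
  nontrivial : ∃ x ∈ ball (0 : EuclideanSpace ℝ (Fin N)) r₀, v x ≠ 0 ∨ w x ≠ 0

/-- `k` is a transmission eigenvalue of the ball of radius `r₀` in `ℝ^N` with material parameters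
`σ, τ`. -/
def IsTransmissionEigenvalue {N : ℕ} (r₀ : ℝ) (σ τ : EuclideanSpace ℝ (Fin N) → ℝ) (k : ℝ) :
    Prop :=
  ∃ v w : EuclideanSpace ℝ (Fin N) → ℂ, IsTransmissionEigenpair r₀ σ τ k v w

/-! ### Surface localization -/

/-- The norm of `L²(A)`. -/
def l2Norm {N : ℕ} (A : Set (EuclideanSpace ℝ (Fin N))) (ψ : EuclideanSpace ℝ (Fin N) → ℂ) : ℝ :=
  (eLpNorm ψ 2 (volume.restrict A)).toReal

/-- `B_ε = {x ∈ B : dist(x, ∂B) ≥ ε}`. -/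
def innerPart {N : ℕ} (B : Set (EuclideanSpace ℝ (Fin N))) (ε : ℝ) :
    Set (EuclideanSpace ℝ (Fin N)) :=
  {x ∈ B | ε ≤ infDist x (frontier B)}

/-- The functions `ψ_m` are nonzero elements of `L²(B)` and are surface-localized in `B` as
`m → ∞`: for every fixed `ε > 0`, however small, `‖ψ_m‖_{L²(B_ε)} / ‖ψ_m‖_{L²(B)} → 0`.
(Equivalently, this quotient tends to `0` along some widths `ε = ε_m > 0` with `ε_m → 0`.) -/
def SurfaceLocalized {N : ℕ} (B : Set (EuclideanSpace ℝ (Fin N)))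
    (ψ : ℕ → EuclideanSpace ℝ (Fin N) → ℂ) : Prop :=
  (∀ m, MemLp (ψ m) 2 (volume.restrict B) ∧ 0 < l2Norm B (ψ m)) ∧
  ∀ ε : ℝ, 0 < ε →
    Tendsto (fun m => l2Norm (innerPart B ε) (ψ m) / l2Norm B (ψ m)) atTop (𝓝 0)

end TransmissionModes

end

/-! Separation of variables reduces the problem to one radial equation. Put `Φ_ν(s) = ∑ (-1)^p s^p /
(p! Γ(p+ν+1))` and `φ_ν(x) = Φ_ν((x/2)²)`. If `H` is a harmonic function, homogeneous of degree `m`,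
and `ν = m + N/2 - 1`, then `φ_ν(κ|x|) H(x)` solves the Helmholtz equation with wavenumber `κ` and
is smooth at the origin. The planar and spatial modes are constant multiples of such functions, so
both dimensions are treated at once (`exists_transmission_indices`).

On the sphere `H` factors out of both transmission conditions. The Dirichlet condition fixes the
ratio of the amplitudes, and the Neumann condition becomes a scalar equation for `z = k n r₀`.
Between consecutive zeros of `J_ν` that equation changes sign: at the endpoints only the term with
`φ_{ν+1}` survives, and `φ_{ν+1}` has opposite signs there because it is a negative multiple of
`φ_ν'` and the zeros are simple (`exists_transmission_root`).

Localization rests on two facts about large order. Below its order, `J_ν` is positive and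
increasing, and a fixed dilation changes it by a factor of order at least `ν²`
(`scaledBessel_growth`). For fixed `s`, Sturm comparison gives `j_{ν,s} ≤ (1+δ)ν` eventually
(`eventually_besselZero_le`). Hence, on any strictly smaller concentric ball, the arguments of both
radial factors eventually stay below a fixed fraction of `ν`, where the growth estimate makes the
inner `L²` norm negligible (`surfaceLocalized_radialMode`). -/

namespace TransmissionModes

/-! ### The entire function behind the Bessel functions -/

/-- The entire function `Φ_ν(s) = ∑_p (-1)^p / (p! Γ(p+ν+1)) s^p`, for which
`J_ν(x) = (x/2)^ν Φ_ν((x/2)²)`. -/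
noncomputable def besselSeries (ν s : ℝ) : ℝ :=
  ∑' p : ℕ, (-1 : ℝ) ^ p / ((p.factorial : ℝ) * Real.Gamma ((p : ℝ) + ν + 1)) * s ^ p

theorem besselJ_eq (ν x : ℝ) : besselJ ν x = (x / 2) ^ ν * besselSeries ν ((x / 2) ^ 2) := by
  simp only [besselJ, besselSeries, pow_mul]

theorem sphericalBesselJ_eq_series (m : ℕ) (x : ℝ) :
    sphericalBesselJ m x =
      √Real.pi / 2 * (x / 2) ^ m * besselSeries ((m : ℝ) + 1 / 2) ((x / 2) ^ 2) := by
  simp only [sphericalBesselJ, besselSeries, pow_mul]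

section
variable {ν : ℝ} (hν : 0 ≤ ν)
include hν

theorem Gamma_pos_of_order (p : ℕ) : 0 < Real.Gamma ((p : ℝ) + ν + 1) :=
  Real.Gamma_pos_of_pos (by positivity)

theorem Gamma_order_succ (p : ℕ) :
    Real.Gamma (((p + 1 : ℕ) : ℝ) + ν + 1) = ((p : ℝ) + ν + 1) * Real.Gamma ((p : ℝ) + ν + 1) := by
  rw [← Real.Gamma_add_one (by positivity)]
  congr 1
  push_cast
  ring

/-- `Γ` is not monotone near `1`, but each unit step multiplies it by `p + ν + 1 ≥ 1`. This
dominates the series by an exponential series. -/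
theorem Gamma_order_le (p : ℕ) : Real.Gamma (ν + 1) ≤ Real.Gamma ((p : ℝ) + ν + 1) := by
  induction p with
  | zero => simp
  | succ p ih =>
    rw [Gamma_order_succ hν]
    have h1 := Gamma_pos_of_order hν p
    have h2 : (0 : ℝ) ≤ p := p.cast_nonneg
    nlinarith

theorem abs_besselCoeff_le (p : ℕ) :
    |(-1 : ℝ) ^ p / ((p.factorial : ℝ) * Real.Gamma ((p : ℝ) + ν + 1))| ≤
      (Real.Gamma (ν + 1))⁻¹ * (p.factorial : ℝ)⁻¹ := by
  have h1 := Gamma_order_le hν p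
  have h2 : 0 < Real.Gamma (ν + 1) := Real.Gamma_pos_of_pos (by positivity)
  have h3 : (0 : ℝ) < p.factorial := by positivity
  rw [abs_div, abs_pow, abs_neg, abs_one, one_pow, one_div, ← mul_inv, abs_of_pos
    (mul_pos h3 (h2.trans_le h1)), mul_comm]
  gcongr

theorem summable_besselSeries (s : ℝ) :
    Summable fun p : ℕ =>
      (-1 : ℝ) ^ p / ((p.factorial : ℝ) * Real.Gamma ((p : ℝ) + ν + 1)) * s ^ p := by
  refine Summable.of_norm_bounded
    ((Real.summable_pow_div_factorial |s|).mul_left (Real.Gamma (ν + 1))⁻¹) fun p => ?_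
  rw [norm_mul, Real.norm_eq_abs, norm_pow, Real.norm_eq_abs, div_eq_inv_mul (|s| ^ p),
    ← mul_assoc]
  exact mul_le_mul_of_nonneg_right (abs_besselCoeff_le hν p) (by positivity)

omit hν in
theorem besselCoeff_succ (p : ℕ) :
    (-1 : ℝ) ^ (p + 1) / (((p + 1).factorial : ℝ) * Real.Gamma (((p + 1 : ℕ) : ℝ) + ν + 1)) *
        ((p + 1 : ℕ) : ℝ) =
      -((-1 : ℝ) ^ p / ((p.factorial : ℝ) * Real.Gamma ((p : ℝ) + (ν + 1) + 1))) := by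
  have e : ((p + 1 : ℕ) : ℝ) + ν + 1 = (p : ℝ) + (ν + 1) + 1 := by push_cast; ring
  rw [e, Nat.factorial_succ, pow_succ]
  have h3 : (0 : ℝ) < p.factorial := by positivity
  have h4 : ((p + 1 : ℕ) : ℝ) ≠ 0 := by positivity
  push_cast at h4 ⊢
  -- The order is unrestricted here, so `Γ` may take its default value `0` at a pole; both sides are
  -- then `0`.
  by_cases h : Real.Gamma ((p : ℝ) + (ν + 1) + 1) = 0
  · simp [h]
  · field_simp

/-- Termwise differentiation, dominated uniformly on a ball around `0` containing `s`; shifting the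
index turns the differentiated series into the series of the next order. -/
theorem hasDerivAt_besselSeries (s : ℝ) :
    HasDerivAt (besselSeries ν) (-besselSeries (ν + 1) s) s := by
  set c : ℕ → ℝ := fun p => (-1 : ℝ) ^ p / ((p.factorial : ℝ) * Real.Gamma ((p : ℝ) + ν + 1))
    with hc
  set R : ℝ := |s| + 1
  have hR : 0 < R := by positivity
  have hs : s ∈ ball (0 : ℝ) R := by simp [R]
  have hu : Summable fun p : ℕ =>
      (Real.Gamma (ν + 1))⁻¹ * ((p.factorial : ℝ)⁻¹ * (p * R ^ (p - 1))) := by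
    refine Summable.mul_left _ ((summable_nat_add_iff 1).1 ?_)
    refine (Real.summable_pow_div_factorial R).congr fun p => ?_
    rw [Nat.factorial_succ, Nat.add_sub_cancel]
    have h4 : ((p + 1 : ℕ) : ℝ) ≠ 0 := by positivity
    push_cast at h4 ⊢
    field_simp
  have hb : ∀ (p : ℕ) (y : ℝ), y ∈ ball (0 : ℝ) R → ‖c p * (p * y ^ (p - 1))‖ ≤
      (Real.Gamma (ν + 1))⁻¹ * ((p.factorial : ℝ)⁻¹ * (p * R ^ (p - 1))) := by
    intro p y hy
    have hy' : |y| ≤ R := by simpa using (mem_ball_zero_iff.1 hy).le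
    rw [norm_mul, norm_mul, norm_pow, Real.norm_natCast, Real.norm_eq_abs, Real.norm_eq_abs,
      ← mul_assoc (Real.Gamma (ν + 1))⁻¹]
    have h2 : 0 < Real.Gamma (ν + 1) := Real.Gamma_pos_of_pos (by positivity)
    gcongr
    exact abs_besselCoeff_le hν p
  have hd := hasDerivAt_tsum_of_isPreconnected (g := fun p y => c p * y ^ p)
    (g' := fun p y => c p * (p * y ^ (p - 1))) (y := s) hu isOpen_ball
    (convex_ball (0 : ℝ) R).isPreconnected
    (fun p y _ => (hasDerivAt_pow p y).const_mul (c p)) hb hs (summable_besselSeries hν s) hs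
  have hsum : Summable fun p : ℕ => c p * (p * s ^ (p - 1)) :=
    Summable.of_norm_bounded hu fun p => hb p s hs
  convert! hd using 1
  rw [hsum.tsum_eq_zero_add, besselSeries, ← tsum_neg]
  simp only [Nat.cast_zero, zero_mul, mul_zero, zero_add, Nat.add_sub_cancel]
  refine tsum_congr fun p => ?_
  rw [← mul_assoc, hc, besselCoeff_succ, neg_mul]

/-- Since `Φ_ν' = -Φ_{ν+1}`, this is Bessel's equation in the form `sΦ'' + (ν+1)Φ' + Φ = 0`. The
coefficients match by the functional equation of `Γ`. -/
theorem besselSeries_recurrence (s : ℝ) :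
    s * besselSeries (ν + 2) s - (ν + 1) * besselSeries (ν + 1) s + besselSeries ν s = 0 := by
  have h0 := summable_besselSeries hν s
  have h1 := summable_besselSeries (ν := ν + 1) (by positivity) s
  have h2 := summable_besselSeries (ν := ν + 2) (by positivity) s
  have e : besselSeries ν s - (ν + 1) * besselSeries (ν + 1) s =
      -(s * besselSeries (ν + 2) s) := by
    simp only [besselSeries]
    rw [← tsum_mul_left, ← tsum_mul_left, ← h0.tsum_sub (h1.mul_left _),
      (h0.sub (h1.mul_left _)).tsum_eq_zero_add, ← tsum_neg]
    have hG : Real.Gamma (ν + 1 + 1) = (ν + 1) * Real.Gamma (ν + 1) :=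
      Real.Gamma_add_one (by positivity)
    have hp : 0 < Real.Gamma (ν + 1) := Real.Gamma_pos_of_pos (by positivity)
    have z : (-1 : ℝ) ^ 0 / (((0 : ℕ).factorial : ℝ) * Real.Gamma (((0 : ℕ) : ℝ) + ν + 1)) * s ^ 0 -
        (ν + 1) * ((-1 : ℝ) ^ 0 / (((0 : ℕ).factorial : ℝ) *
          Real.Gamma (((0 : ℕ) : ℝ) + (ν + 1) + 1)) * s ^ 0) = 0 := by
      simp only [Nat.cast_zero, zero_add, hG, pow_zero, Nat.factorial_zero, Nat.cast_one]
      field_simp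
      ring
    rw [z, zero_add]
    refine tsum_congr fun p => ?_
    have g1 := Gamma_pos_of_order hν (p + 1)
    have e1 : ((p + 1 : ℕ) : ℝ) + (ν + 1) + 1 = (((p + 1 : ℕ) : ℝ) + ν + 1) + 1 := by ring
    have e2 : (p : ℝ) + (ν + 2) + 1 = (((p + 1 : ℕ) : ℝ) + ν + 1) + 1 := by push_cast; ring
    rw [e1, e2, Real.Gamma_add_one (s := ((p + 1 : ℕ) : ℝ) + ν + 1) (by positivity),
      Nat.factorial_succ]
    generalize Real.Gamma (((p + 1 : ℕ) : ℝ) + ν + 1) = G at g1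
    have h5 : ((p : ℝ) + 1 + ν + 1) ≠ 0 := by positivity
    have h6 : (p : ℝ) + 1 ≠ 0 := by positivity
    push_cast
    field_simp
    ring
  linarith

theorem besselSeries_zero : besselSeries ν 0 = (Real.Gamma (ν + 1))⁻¹ := by
  rw [besselSeries, (summable_besselSeries hν 0).tsum_eq_zero_add]
  simp

theorem besselSeries_zero_pos : 0 < besselSeries ν 0 := by
  rw [besselSeries_zero hν]
  exact inv_pos.2 (Real.Gamma_pos_of_pos (by positivity))

end

theorem contDiff_besselSeries (n : ℕ) : ∀ {ν : ℝ}, 0 ≤ ν → ContDiff ℝ n (besselSeries ν) := by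
  induction n with
  | zero =>
    intro ν hν
    exact contDiff_zero.2
      (continuous_iff_continuousAt.2 fun s => (hasDerivAt_besselSeries hν s).continuousAt)
  | succ n ih =>
    intro ν hν
    push_cast
    rw [contDiff_succ_iff_deriv]
    refine ⟨fun s => (hasDerivAt_besselSeries hν s).differentiableAt, by simp, ?_⟩
    rw [funext fun s => (hasDerivAt_besselSeries hν s).deriv]
    exact (ih (by positivity)).neg


/-! ### The even factor `x ↦ Φ_ν((x/2)²)` of the Bessel function -/

/-- The even factor `(x/2)^(-ν) J_ν(x)` of the Bessel function. -/
noncomputable def besselEven (ν x : ℝ) : ℝ := besselSeries ν ((x / 2) ^ 2)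

/-- The product `2^ν J_ν(x) = x^ν Φ_ν((x/2)²)`. -/
noncomputable def scaledBessel (ν x : ℝ) : ℝ := x ^ ν * besselEven ν x

/-- The Euler derivative `x f'(x)` of `f = 2^ν J_ν`. -/
noncomputable def scaledBesselEuler (ν x : ℝ) : ℝ :=
  x ^ ν * (ν * besselEven ν x - x ^ 2 / 2 * besselEven (ν + 1) x)

theorem besselJ_eq_zero_iff {ν x : ℝ} (hx : 0 < x) : besselJ ν x = 0 ↔ besselEven ν x = 0 := by
  have : (x / 2) ^ ν ≠ 0 := (Real.rpow_pos_of_pos (by positivity) ν).ne'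
  rw [besselJ_eq, besselEven, mul_eq_zero, or_iff_right this]

/-! ### Sign tests for real functions. -/

theorem nonneg_of_hasDerivAt_of_eventually_right {f : ℝ → ℝ} {f' p : ℝ} (h : HasDerivAt f f' p)
    (h0 : f p = 0) (hf : ∀ᶠ x in 𝓝[>] p, 0 ≤ f x) : 0 ≤ f' := by
  have ht := (hasDerivWithinAt_iff_tendsto_slope' (Set.notMem_Ioi.2 le_rfl)).1
    (h.hasDerivWithinAt (s := Set.Ioi p))
  refine ge_of_tendsto ht ?_
  filter_upwards [hf, self_mem_nhdsWithin] with x hx hxp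
  rw [slope_def_field, h0, sub_zero]
  exact div_nonneg hx (sub_nonneg.2 (le_of_lt hxp))

theorem nonpos_of_hasDerivAt_of_eventually_left {f : ℝ → ℝ} {f' p : ℝ} (h : HasDerivAt f f' p)
    (h0 : f p = 0) (hf : ∀ᶠ x in 𝓝[<] p, 0 ≤ f x) : f' ≤ 0 := by
  have ht := (hasDerivWithinAt_iff_tendsto_slope' (Set.notMem_Iio.2 le_rfl)).1
    (h.hasDerivWithinAt (s := Set.Iio p))
  refine le_of_tendsto ht ?_
  filter_upwards [hf, self_mem_nhdsWithin] with x hx hxp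
  rw [slope_def_field, h0, sub_zero]
  exact div_nonpos_of_nonneg_of_nonpos hx (sub_nonpos.2 (le_of_lt hxp))

theorem sign_const_of_ne_zero {f : ℝ → ℝ} {a b : ℝ} (hf : Continuous f)
    (h : ∀ x ∈ Set.Ioo a b, f x ≠ 0) :
    (∀ x ∈ Set.Ioo a b, 0 < f x) ∨ (∀ x ∈ Set.Ioo a b, 0 < -f x) := by
  by_contra! hc
  obtain ⟨⟨x, hx, hx0⟩, y, hy, hy0⟩ := hc
  have hc : IsPreconnected (Set.Ioo a b) := isPreconnected_Ioo
  obtain ⟨z, hz, hz0⟩ := hc.intermediate_value hx hy hf.continuousOn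
    (show (0 : ℝ) ∈ Set.Icc (f x) (f y) from ⟨hx0, by linarith⟩)
  exact h z hz hz0

section
variable {ν : ℝ} (hν : 0 ≤ ν)
include hν

theorem besselEven_zero_pos : 0 < besselEven ν 0 := by
  simpa [besselEven] using besselSeries_zero_pos hν

theorem hasDerivAt_besselEven (x : ℝ) :
    HasDerivAt (besselEven ν) (-(x / 2) * besselEven (ν + 1) x) x := by
  have h1 : HasDerivAt (fun x : ℝ => (x / 2) ^ 2) (x / 2) x := by
    have := ((hasDerivAt_id x).div_const 2).fun_pow 2
    convert! this using 1
    simp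
    ring
  have := (hasDerivAt_besselSeries hν ((x / 2) ^ 2)).comp x h1
  convert! this using 1
  simp only [besselEven]
  ring

theorem continuous_besselEven : Continuous (besselEven ν) :=
  continuous_iff_continuousAt.2 fun x => (hasDerivAt_besselEven hν x).continuousAt

theorem besselEven_recurrence (x : ℝ) :
    (x / 2) ^ 2 * besselEven (ν + 2) x =
      (ν + 1) * besselEven (ν + 1) x - besselEven ν x := by
  have := besselSeries_recurrence hν ((x / 2) ^ 2)
  simp only [besselEven]
  linarith

theorem hasDerivAt_scaledBessel {x : ℝ} (hx : 0 < x) :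
    HasDerivAt (scaledBessel ν) (scaledBesselEuler ν x / x) x := by
  have := (Real.hasDerivAt_rpow_const (p := ν) (Or.inl hx.ne')).mul (hasDerivAt_besselEven hν x)
  convert! this using 1
  rw [scaledBesselEuler, Real.rpow_sub_one hx.ne']
  field_simp
  ring

/-- Bessel's equation `x (x f')' = (ν² - x²) f`, which exposes the sign change at `x = ν`. -/
theorem hasDerivAt_scaledBesselEuler {x : ℝ} (hx : 0 < x) :
    HasDerivAt (scaledBesselEuler ν) ((ν ^ 2 - x ^ 2) / x * scaledBessel ν x) x := by
  have h1 : HasDerivAt (fun x : ℝ => x ^ 2 / 2) x x := by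
    convert! (hasDerivAt_pow 2 x).div_const 2 using 1
    simp
  have hA := hasDerivAt_besselEven hν x
  have hB := hasDerivAt_besselEven (ν := ν + 1) (by positivity) x
  have := (Real.hasDerivAt_rpow_const (p := ν) (Or.inl hx.ne')).mul
    ((hA.const_mul ν).sub (h1.mul hB))
  convert! this using 1
  have hr := besselEven_recurrence hν x
  rw [show ν + 1 + 1 = ν + 2 by ring, scaledBessel, Real.rpow_sub_one hx.ne']
  have e : besselEven (ν + 2) x =
      4 / x ^ 2 * ((ν + 1) * besselEven (ν + 1) x - besselEven ν x) := by
    rw [← hr]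
    field_simp
    ring
  rw [e]
  simp only [Pi.sub_apply, Pi.mul_apply]
  field_simp
  ring

theorem continuous_scaledBessel : Continuous (scaledBessel ν) :=
  (Real.continuous_rpow_const hν).mul (continuous_besselEven hν)

theorem continuous_scaledBesselEuler : Continuous (scaledBesselEuler ν) := by
  have h1 := continuous_besselEven hν
  have h2 := continuous_besselEven (ν := ν + 1) (by positivity)
  have h3 := Real.continuous_rpow_const hν
  unfold scaledBesselEuler
  fun_prop

omit hν in
theorem scaledBessel_pos_iff {x : ℝ} (hx : 0 < x) :
    0 < scaledBessel ν x ↔ 0 < besselEven ν x :=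
  mul_pos_iff_of_pos_left (Real.rpow_pos_of_pos hx ν)

/-! ### Positivity and growth below the order. -/

theorem scaledBessel_monotoneOn {b : ℝ} (hb : b ≤ ν)
    (h : ∀ x ∈ Set.Ioo 0 b, 0 ≤ besselEven ν x) :
    MonotoneOn (scaledBesselEuler ν) (Set.Icc 0 b) ∧ MonotoneOn (scaledBessel ν) (Set.Icc 0 b) := by
  have hg : MonotoneOn (scaledBesselEuler ν) (Set.Icc 0 b) := by
    refine monotoneOn_of_deriv_nonneg (convex_Icc 0 b)
      (continuous_scaledBesselEuler hν).continuousOn ?_ ?_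
    · rw [interior_Icc]
      exact fun x hx => (hasDerivAt_scaledBesselEuler hν hx.1).differentiableAt.differentiableWithinAt
    · rw [interior_Icc]
      intro x hx
      rw [(hasDerivAt_scaledBesselEuler hν hx.1).deriv]
      have h1 : 0 < x := hx.1
      have h2 : 0 ≤ ν ^ 2 - x ^ 2 := by nlinarith [hx.2]
      exact mul_nonneg (by positivity) (mul_nonneg (by positivity) (h x hx))
  refine ⟨hg, ?_⟩
  refine monotoneOn_of_deriv_nonneg (convex_Icc 0 b)
    (continuous_scaledBessel hν).continuousOn ?_ ?_
  · rw [interior_Icc]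
    exact fun x hx => (hasDerivAt_scaledBessel hν hx.1).differentiableAt.differentiableWithinAt
  · rw [interior_Icc]
    intro x hx
    rw [(hasDerivAt_scaledBessel hν hx.1).deriv]
    have h0 : scaledBesselEuler ν 0 = 0 := by
      have : ν ≠ 0 := by linarith [hx.1, hx.2]
      simp [scaledBesselEuler, Real.zero_rpow this]
    have h1 := hg ⟨le_rfl, (hx.1.trans hx.2).le⟩ ⟨hx.1.le, hx.2.le⟩ hx.1.le
    rw [h0] at h1
    exact div_nonneg h1 hx.1.le

/-- At a first nonpositive point `b ≤ ν`, monotonicity of `x^ν φ_ν` up to `b` would give a value at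
least the positive one at `b/2`. -/
theorem besselEven_pos {x : ℝ} (hx : 0 ≤ x) (hxν : x ≤ ν) : 0 < besselEven ν x := by
  by_contra hneg
  have hcl : IsCompact (Set.Icc 0 ν ∩ {x | besselEven ν x ≤ 0}) :=
    isCompact_Icc.inter_right (isClosed_le (continuous_besselEven hν) continuous_const)
  obtain ⟨b, ⟨⟨hb0, hbν⟩, hb⟩, hmin⟩ := hcl.exists_isLeast ⟨x, ⟨hx, hxν⟩, not_lt.1 hneg⟩
  have hb0' : 0 < b := by
    rcases hb0.lt_or_eq with h | h
    · exact h
    · rw [← h] at hb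
      exact absurd (besselEven_zero_pos hν) (not_lt.2 hb)
  have hpos : ∀ y, 0 ≤ y → y < b → 0 < besselEven ν y := by
    intro y hy hyb
    by_contra hn
    exact absurd (hmin ⟨⟨hy, hyb.le.trans hbν⟩, not_lt.1 hn⟩) (not_le.2 hyb)
  have hm := (scaledBessel_monotoneOn hν hbν fun y hy => (hpos y hy.1.le hy.2).le).2
    (show b / 2 ∈ Set.Icc 0 b from ⟨by positivity, by linarith⟩) ⟨hb0, le_rfl⟩ (by linarith)
  have h1 := (scaledBessel_pos_iff (ν := ν) (x := b / 2) (by positivity)).2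
    (hpos _ (by positivity) (by linarith))
  have h2 := (scaledBessel_pos_iff (ν := ν) hb0').1 (h1.trans_le hm)
  exact absurd h2 (not_lt.2 hb)

/-- Below its order, the Bessel function grows at a definite rate. -/
theorem scaledBessel_growth {θ y : ℝ} (hθ0 : 0 < θ) (hθ1 : θ < 1) (hy : 0 < y) (hyν : y < ν) :
    (ν ^ 2 - y ^ 2) * (1 - θ) ^ 2 / 2 * scaledBessel ν (θ * y) ≤ scaledBessel ν y := by
  obtain ⟨hg, hf⟩ := scaledBessel_monotoneOn hν le_rfl fun x hx =>
    (besselEven_pos hν hx.1.le hx.2.le).le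
  set x := θ * y with hx
  have hx0 : 0 < x := by positivity
  have hxy : x < y := by nlinarith
  -- `K` bounds the derivative of the Euler derivative `t f'` from below on `[x, y]`. Integrating
  -- twice gives `t f' ≥ K(t - x)` and then `f(y) ≥ f(x) + K(y - x)²/(2y)`, where `y - x = (1 -
  -- θ)y`.
  set K := (ν ^ 2 - y ^ 2) / y * scaledBessel ν x with hK
  have hfx : 0 < scaledBessel ν x :=
    (scaledBessel_pos_iff hx0).2 (besselEven_pos hν hx0.le (hxy.trans hyν).le)
  have hsq : 0 < ν ^ 2 - y ^ 2 := by nlinarith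
  have hK0 : 0 < K := by positivity
  have hgx : 0 ≤ scaledBesselEuler ν x := by
    have h0 : scaledBesselEuler ν 0 = 0 := by
      have : ν ≠ 0 := by linarith
      simp [scaledBesselEuler, Real.zero_rpow this]
    have := hg (show (0 : ℝ) ∈ Set.Icc 0 ν from ⟨le_rfl, hν⟩) ⟨hx0.le, (hxy.trans hyν).le⟩ hx0.le
    rwa [h0] at this
  have hint : interior (Set.Icc x y) = Set.Ioo x y := interior_Icc
  have lin : ∀ t : ℝ, HasDerivAt (fun t => K * (t - x)) K t := fun t => by
    simpa using ((hasDerivAt_id t).sub_const x).const_mul K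
  have quad : ∀ t : ℝ, HasDerivAt (fun t => K / (2 * y) * (t - x) ^ 2) (K * (t - x) / y) t := by
    intro t
    convert! (((hasDerivAt_id t).sub_const x).fun_pow 2).const_mul (K / (2 * y)) using 1
    simp only [id]
    field_simp
    ring
  have m1 : MonotoneOn (fun t => scaledBesselEuler ν t - K * (t - x)) (Set.Icc x y) := by
    have hd : ∀ t, 0 < t → HasDerivAt (fun t => scaledBesselEuler ν t - K * (t - x))
        ((ν ^ 2 - t ^ 2) / t * scaledBessel ν t - K) t :=
      fun t ht => (hasDerivAt_scaledBesselEuler hν ht).sub (lin t)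
    refine monotoneOn_of_deriv_nonneg (convex_Icc x y)
      (fun t ht => (hd t (hx0.trans_le ht.1)).continuousAt.continuousWithinAt) ?_ ?_
    · rw [hint]
      exact fun t ht => (hd t (hx0.trans ht.1)).differentiableAt.differentiableWithinAt
    · rw [hint]
      intro t ht
      have ht0 : 0 < t := hx0.trans ht.1
      rw [(hd t ht0).deriv, sub_nonneg, hK]
      have h1 : scaledBessel ν x ≤ scaledBessel ν t :=
        hf ⟨hx0.le, (hxy.trans hyν).le⟩ ⟨ht0.le, (ht.2.trans hyν).le⟩ ht.1.le
      have h3 : 0 ≤ ν ^ 2 - t ^ 2 := by nlinarith [ht.2]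
      exact mul_le_mul (div_le_div₀ h3 (by nlinarith [ht.2]) ht0 ht.2.le) h1 hfx.le
        (by positivity)
  have m2 : MonotoneOn (fun t => scaledBessel ν t - K / (2 * y) * (t - x) ^ 2) (Set.Icc x y) := by
    have hd : ∀ t, 0 < t → HasDerivAt (fun t => scaledBessel ν t - K / (2 * y) * (t - x) ^ 2)
        (scaledBesselEuler ν t / t - K * (t - x) / y) t :=
      fun t ht => (hasDerivAt_scaledBessel hν ht).sub (quad t)
    refine monotoneOn_of_deriv_nonneg (convex_Icc x y)
      (fun t ht => (hd t (hx0.trans_le ht.1)).continuousAt.continuousWithinAt) ?_ ?_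
    · rw [hint]
      exact fun t ht => (hd t (hx0.trans ht.1)).differentiableAt.differentiableWithinAt
    · rw [hint]
      intro t ht
      have ht0 : 0 < t := hx0.trans ht.1
      rw [(hd t ht0).deriv, sub_nonneg]
      have h1 := m1 ⟨le_rfl, hxy.le⟩ ⟨ht.1.le, ht.2.le⟩ ht.1.le
      simp only [sub_self, mul_zero, sub_zero] at h1
      have h3 := ht.2.le
      have h4 : 0 ≤ t - x := sub_nonneg.2 ht.1.le
      calc K * (t - x) / y ≤ K * (t - x) / t := by gcongr
        _ ≤ scaledBesselEuler ν t / t := by gcongr; linarith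
  have h1 := m2 ⟨le_rfl, hxy.le⟩ ⟨hxy.le, le_rfl⟩ hxy.le
  simp only [sub_self] at h1
  have e : K / (2 * y) * (y - x) ^ 2 =
      (ν ^ 2 - y ^ 2) * (1 - θ) ^ 2 / 2 * scaledBessel ν x := by
    rw [hK]
    have : y - x = (1 - θ) * y := by rw [hx]; ring
    rw [this]
    field_simp
  rw [← e]
  norm_num at h1
  linarith

/-! ### Simplicity and existence of zeros. -/

/-- An energy argument that carries uniqueness down to the singular point `0`: if `φ_ν` and `φ_ν'`
both vanish at `x`, a weighted energy that is nondecreasing and nonnegative must vanish on `(0, x]`,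
contradicting `φ_ν(0) > 0`. -/
theorem besselEven_simple_zero {x : ℝ} (hx : 0 < x) (h : besselEven ν x = 0) :
    besselEven (ν + 1) x ≠ 0 := by
  intro h'
  -- The energy `φ_ν² + (φ_ν')²` loses at most `(4ν + 2)/t` times itself, so the weight `t^(q+1)`
  -- makes it nondecreasing.
  obtain ⟨q, hq⟩ := exists_nat_ge (4 * ν + 2)
  have hA := hasDerivAt_besselEven hν
  have hB := hasDerivAt_besselEven (ν := ν + 1) (by positivity)
  have hr := besselEven_recurrence hν
  rw [show ν + 1 + 1 = ν + 2 by ring] at hB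
  set A := besselEven ν
  set B := besselEven (ν + 1)
  have hd : ∀ t, HasDerivAt (fun t => t ^ (q + 1) * (A t ^ 2 + (t / 2 * B t) ^ 2))
      (t ^ q * ((q + 1) * (A t ^ 2 + (t / 2 * B t) ^ 2) - (4 * ν + 2) * (t / 2 * B t) ^ 2)) t := by
    intro t
    have := (hasDerivAt_pow (q + 1) t).mul (((hA t).fun_pow 2).add
      ((((hasDerivAt_id t).div_const 2).mul (hB t)).fun_pow 2))
    convert! this using 1
    simp only [Pi.add_apply, Pi.mul_apply, id]
    have := hr t
    have e : t / 2 * (-(t / 2) * besselEven (ν + 2) t) = -((ν + 1) * B t - A t) := by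
      rw [← this]
      ring
    rw [e]
    simp only [Nat.add_sub_cancel, Nat.cast_add, Nat.cast_one]
    ring
  have hm : MonotoneOn (fun t => t ^ (q + 1) * (A t ^ 2 + (t / 2 * B t) ^ 2)) (Set.Icc 0 x) := by
    refine monotoneOn_of_deriv_nonneg (convex_Icc 0 x)
      (fun t _ => (hd t).continuousAt.continuousWithinAt)
      (fun t _ => (hd t).differentiableAt.differentiableWithinAt) ?_
    rw [interior_Icc]
    intro t ht
    rw [(hd t).deriv]
    have h1 := pow_pos ht.1 q
    have h2 := sq_nonneg (A t)
    have h3 := sq_nonneg (t / 2 * B t)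
    refine mul_nonneg h1.le ?_
    nlinarith
  have hz : ∀ t ∈ Set.Ioc 0 x, A t = 0 := by
    intro t ht
    have h1 := hm ⟨ht.1.le, ht.2⟩ ⟨hx.le, le_rfl⟩ ht.2
    simp only [h, h'] at h1
    have h2 := pow_pos ht.1 (q + 1)
    have h3 := sq_nonneg (A t)
    have h4 := sq_nonneg (t / 2 * B t)
    have h5 : A t ^ 2 + (t / 2 * B t) ^ 2 ≤ 0 := by
      by_contra hc
      have := mul_pos h2 (not_le.1 hc)
      norm_num at h1
      linarith
    exact pow_eq_zero_iff (two_ne_zero) |>.1 (by linarith)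
  have h0 : A 0 = 0 := by
    have ht : Tendsto A (𝓝[>] 0) (𝓝 (A 0)) := (hA 0).continuousAt.continuousWithinAt
    refine tendsto_nhds_unique ht (tendsto_const_nhds.congr' ?_)
    filter_upwards [Ioc_mem_nhdsGT hx] with t ht using (hz t ht).symm
  exact (besselEven_zero_pos hν).ne' h0

theorem eventually_besselEven_ne_zero {y : ℝ} (hy : 0 ≤ y) :
    ∀ᶠ x in 𝓝[>] y, besselEven ν x ≠ 0 := by
  by_cases h : besselEven ν y = 0
  · have hy' : 0 < y := hy.lt_of_ne fun e => (besselEven_zero_pos hν).ne' (e ▸ h)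
    have := (hasDerivAt_besselEven hν y).eventually_ne (c := 0)
      (mul_ne_zero (by linarith) (besselEven_simple_zero hν hy' h))
    exact this.filter_mono (nhdsWithin_mono _ fun x hx => ne_of_gt hx)
  · exact ((continuous_besselEven hν).continuousAt.eventually_ne h).filter_mono nhdsWithin_le_nhds

/-- Sturm comparison of `J_ν` with `sin (c log (x / a))`. -/
theorem exists_besselEven_zero {a c : ℝ} (ha : 0 < a) (hc : 0 < c) (hac : ν ^ 2 + c ^ 2 ≤ a ^ 2) :
    ∃ x ∈ Set.Ioo a (a * Real.exp (Real.pi / c)), besselEven ν x = 0 := by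
  by_contra! hne
  set b := a * Real.exp (Real.pi / c) with hb
  have hπ : 0 < Real.pi / c := div_pos Real.pi_pos hc
  have hab : a < b := lt_mul_of_one_lt_right ha (Real.one_lt_exp_iff.2 hπ)
  obtain ⟨ε, hε⟩ : ∃ ε : ℝ, ∀ x ∈ Set.Ioo a b, 0 < ε * scaledBessel ν x := by
    have hp : ∀ x ∈ Set.Ioo a b, 0 < x ^ ν := fun x hx => Real.rpow_pos_of_pos (ha.trans hx.1) ν
    rcases sign_const_of_ne_zero (continuous_besselEven hν) hne with h | h
    · exact ⟨1, fun x hx => by rw [one_mul]; exact mul_pos (hp x hx) (h x hx)⟩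
    · refine ⟨-1, fun x hx => ?_⟩
      have := mul_pos (hp x hx) (h x hx)
      simp only [scaledBessel]
      linarith
  have hend : ∀ x ∈ Set.Icc a b, 0 ≤ ε * scaledBessel ν x := by
    have hcl : IsClosed {x | 0 ≤ ε * scaledBessel ν x} :=
      isClosed_le continuous_const (continuous_const.mul (continuous_scaledBessel hν))
    rw [← closure_Ioo hab.ne]
    exact fun x hx => closure_minimal (fun y hy => (hε y hy).le) hcl hx
  -- The comparison function `u = sin (c log (x/a))` satisfies `x (x u')' = -c² u`, and `W` is `x`
  -- times the Wronskian. It would increase strictly on `[a, b]`, yet `W a ≥ 0 ≥ W b` because `u`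
  -- vanishes at both ends with opposite slopes.
  set W : ℝ → ℝ := fun x => ε * scaledBessel ν x * (c * Real.cos (c * Real.log (x / a))) -
    ε * scaledBesselEuler ν x * Real.sin (c * Real.log (x / a)) with hW
  have hd : ∀ x, 0 < x → HasDerivAt W ((x ^ 2 - ν ^ 2 - c ^ 2) / x *
      (ε * scaledBessel ν x * Real.sin (c * Real.log (x / a)))) x := by
    intro x hx
    have h1 : HasDerivAt (fun x => c * Real.log (x / a)) (c / x) x := by
      have := (((hasDerivAt_id x).div_const a).log (by simp; exact ⟨hx.ne', ha.ne'⟩)).const_mul c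
      convert! this using 1
      simp only [id]
      field_simp
    have := (((hasDerivAt_scaledBessel hν hx).const_mul ε).mul (h1.cos.const_mul c)).sub
      (((hasDerivAt_scaledBesselEuler hν hx).const_mul ε).mul h1.sin)
    convert! this using 1
    field_simp
    ring
  have hmono : StrictMonoOn W (Set.Icc a b) := by
    refine strictMonoOn_of_deriv_pos (convex_Icc a b)
      (fun x hx => (hd x (ha.trans_le hx.1)).continuousAt.continuousWithinAt) ?_
    rw [interior_Icc]
    intro x hx
    have hx0 : 0 < x := ha.trans hx.1
    rw [(hd x hx0).deriv]
    have h1 : 0 < x ^ 2 - ν ^ 2 - c ^ 2 := by nlinarith [hx.1]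
    have h2 : 0 < Real.log (x / a) := Real.log_pos ((one_lt_div ha).2 hx.1)
    have h3 : Real.log (x / a) < Real.pi / c := by
      rw [Real.log_lt_iff_lt_exp (by positivity), div_lt_iff₀ ha, mul_comm]
      exact hx.2
    have h4 : 0 < Real.sin (c * Real.log (x / a)) := by
      refine Real.sin_pos_of_pos_of_lt_pi (by positivity) ?_
      rw [lt_div_iff₀ hc] at h3
      linarith
    have h5 := hε x hx
    positivity
  have h := hmono ⟨le_rfl, hab.le⟩ ⟨hab.le, le_rfl⟩ hab
  have ea : W a = c * (ε * scaledBessel ν a) := by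
    simp [hW, div_self ha.ne']
    ring
  have eb : W b = -(c * (ε * scaledBessel ν b)) := by
    have : c * Real.log (b / a) = Real.pi := by
      rw [hb, mul_div_cancel_left₀ _ ha.ne', Real.log_exp]
      field_simp
    simp [hW, this]
    ring
  rw [ea, eb] at h
  have h1 := mul_nonneg hc.le (hend a ⟨le_rfl, hab.le⟩)
  have h2 := mul_nonneg hc.le (hend b ⟨hab.le, le_rfl⟩)
  linarith

end


/-! ### The positive zeros -/

theorem besselJ_ne_zero_of_le_order {ν x : ℝ} (hx : 0 < x) (h : x ≤ ν) : besselJ ν x ≠ 0 := by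
  rw [Ne, besselJ_eq_zero_iff hx]
  exact (besselEven_pos (hx.le.trans h) hx.le h).ne'

section
variable {ν : ℝ} (hν : 0 ≤ ν)
include hν

theorem exists_besselJ_zero_between {y a c : ℝ} (ha : 0 < a) (hc : 0 < c)
    (hac : ν ^ 2 + c ^ 2 ≤ a ^ 2) (hya : y ≤ a) :
    ∃ x, x ≤ a * Real.exp (Real.pi / c) ∧ x ∈ {x : ℝ | y < x ∧ besselJ ν x = 0} := by
  obtain ⟨x, hx, h0⟩ := exists_besselEven_zero hν ha hc hac
  exact ⟨x, hx.2.le, hya.trans_lt hx.1, (besselJ_eq_zero_iff (ha.trans hx.1)).2 h0⟩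

theorem exists_besselJ_zero_gt {y : ℝ} (hy : 0 ≤ y) :
    {x : ℝ | y < x ∧ besselJ ν x = 0}.Nonempty := by
  obtain ⟨x, -, hx⟩ := exists_besselJ_zero_between hν (a := y + ν + 1) (c := 1) (by positivity)
    one_pos (by nlinarith) (by linarith)
  exact ⟨x, hx⟩

/-- Zeros do not accumulate at `y` from the right, so the set of later zeros is closed and its
infimum is attained. This makes the recursive `besselZero` a genuine enumeration. -/
theorem sInf_besselJ_zero_mem {y : ℝ} (hy : 0 ≤ y) :
    sInf {x : ℝ | y < x ∧ besselJ ν x = 0} ∈ {x : ℝ | y < x ∧ besselJ ν x = 0} := by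
  obtain ⟨u, hu, hne⟩ := mem_nhdsGT_iff_exists_Ioo_subset.1 (eventually_besselEven_ne_zero hν hy)
  have hu : y < u := hu
  have e : {x : ℝ | y < x ∧ besselJ ν x = 0} = {x : ℝ | u ≤ x ∧ besselEven ν x = 0} := by
    ext x
    constructor
    · rintro ⟨h1, h2⟩
      rw [besselJ_eq_zero_iff (hy.trans_lt h1)] at h2
      refine ⟨?_, h2⟩
      by_contra! hxu
      exact hne ⟨h1, hxu⟩ h2
    · rintro ⟨h1, h2⟩
      exact ⟨hu.trans_le h1, (besselJ_eq_zero_iff (hy.trans_lt (hu.trans_le h1))).2 h2⟩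
  have hcl : IsClosed {x : ℝ | u ≤ x ∧ besselEven ν x = 0} :=
    (isClosed_le continuous_const continuous_id).inter
      (isClosed_eq (continuous_besselEven hν) continuous_const)
  have hn := exists_besselJ_zero_gt hν hy
  rw [e] at hn ⊢
  exact hcl.csInf_mem hn ⟨u, fun x hx => hx.1⟩

theorem besselZero_nonneg (s : ℕ) : 0 ≤ besselZero ν s := by
  induction s with
  | zero => exact le_rfl
  | succ s ih => exact ih.trans (sInf_besselJ_zero_mem hν ih).1.le

theorem besselZero_lt_succ (s : ℕ) : besselZero ν s < besselZero ν (s + 1) :=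
  (sInf_besselJ_zero_mem hν (besselZero_nonneg hν s)).1

theorem besselZero_succ_pos (s : ℕ) : 0 < besselZero ν (s + 1) :=
  (besselZero_nonneg hν s).trans_lt (besselZero_lt_succ hν s)

theorem besselEven_besselZero_succ (s : ℕ) : besselEven ν (besselZero ν (s + 1)) = 0 :=
  (besselJ_eq_zero_iff (besselZero_succ_pos hν s)).1
    (sInf_besselJ_zero_mem hν (besselZero_nonneg hν s)).2

theorem besselEven_ne_zero_between (s : ℕ) :
    ∀ x ∈ Set.Ioo (besselZero ν s) (besselZero ν (s + 1)), besselEven ν x ≠ 0 := by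
  intro x hx h
  have h0 := besselZero_nonneg hν s
  have : besselZero ν (s + 1) ≤ x :=
    csInf_le ⟨besselZero ν s, fun y hy => hy.1.le⟩
      ⟨hx.1, (besselJ_eq_zero_iff (h0.trans_lt hx.1)).2 h⟩
  exact absurd hx.2 (not_lt.2 this)

/-- Beyond `a`, every interval whose endpoints have ratio `exp (π/c)` contains a zero, so each
further zero costs at most one such factor. -/
theorem besselZero_le {a c : ℝ} (ha : 0 < a) (hc : 0 < c) (hac : ν ^ 2 + c ^ 2 ≤ a ^ 2) (s : ℕ) :
    besselZero ν s ≤ a * Real.exp (Real.pi / c) ^ s := by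
  induction s with
  | zero => simpa [besselZero] using ha.le
  | succ s ih =>
    have h1 : 1 ≤ Real.exp (Real.pi / c) :=
      Real.one_le_exp (div_nonneg Real.pi_pos.le hc.le)
    have h2 : a ≤ a * Real.exp (Real.pi / c) ^ s := le_mul_of_one_le_right ha.le (one_le_pow₀ h1)
    obtain ⟨x, hx, hm⟩ := exists_besselJ_zero_between hν (a := a * Real.exp (Real.pi / c) ^ s)
      (by positivity) hc (by nlinarith) ih
    rw [pow_succ, ← mul_assoc]
    exact (csInf_le ⟨besselZero ν s, fun y hy => hy.1.le⟩ hm).trans hx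

/-- The logarithmic derivative of `x ↦ x^d Φ_ν((x/2)²)` takes every real value between two
consecutive zeros of `J_ν`. -/
theorem exists_transmission_root (s d : ℕ) {σ : ℝ} (hσ : 0 < σ) (R : ℝ) :
    ∃ z ∈ Set.Ioo (besselZero ν (s + 1)) (besselZero ν (s + 2)), besselEven ν R ≠ 0 →
      σ * (d * besselEven ν z - z ^ 2 / 2 * besselEven (ν + 1) z) * besselEven ν R =
        (d * besselEven ν R - R ^ 2 / 2 * besselEven (ν + 1) R) * besselEven ν z := by
  have hp0 := besselZero_succ_pos hν s
  have hq0 := besselZero_succ_pos hν (s + 1)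
  have hp := besselEven_besselZero_succ hν s
  have hq := besselEven_besselZero_succ hν (s + 1)
  have hne := besselEven_ne_zero_between hν (s + 1)
  have hpq := besselZero_lt_succ hν (s + 1)
  rw [show s + 1 + 1 = s + 2 from rfl] at *
  set p := besselZero ν (s + 1)
  set q := besselZero ν (s + 2)
  by_cases hR : besselEven ν R = 0
  -- No equation is required in this case, but a point in the interval is still supplied:
  -- localization is claimed along all `m`, including those with `J_ν(k r₀) = 0`.
  · exact ⟨(p + q) / 2, ⟨by linarith, by linarith⟩, fun h => absurd hR h⟩
  have hcA := continuous_besselEven hν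
  have hcB := continuous_besselEven (ν := ν + 1) (by positivity)
  have hBp := besselEven_simple_zero hν hp0 hp
  have hBq := besselEven_simple_zero hν hq0 hq
  -- `φ_ν' = -(x/2) φ_{ν+1}`, and a function of one sign between consecutive simple zeros has slopes
  -- of opposite signs there.
  have hsign : besselEven (ν + 1) p * besselEven (ν + 1) q < 0 := by
    have key : ∀ ε : ℝ, (∀ x ∈ Set.Ioo p q, 0 < ε * besselEven ν x) →
        ε * besselEven (ν + 1) p ≤ 0 ∧ 0 ≤ ε * besselEven (ν + 1) q := by
      intro ε hε
      have h1 := nonneg_of_hasDerivAt_of_eventually_right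
        ((hasDerivAt_besselEven hν p).const_mul ε) (by rw [hp, mul_zero]) (by
          filter_upwards [Ioo_mem_nhdsGT hpq] with x hx using (hε x hx).le)
      have h2 := nonpos_of_hasDerivAt_of_eventually_left
        ((hasDerivAt_besselEven hν q).const_mul ε) (by rw [hq, mul_zero]) (by
          filter_upwards [Ioo_mem_nhdsLT hpq] with x hx using (hε x hx).le)
      constructor <;> by_contra! hc
      · nlinarith
      · nlinarith
    have hne0 : besselEven (ν + 1) p * besselEven (ν + 1) q ≠ 0 := mul_ne_zero hBp hBq
    refine lt_of_le_of_ne ?_ hne0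
    rcases sign_const_of_ne_zero hcA hne with h | h
    · obtain ⟨h1, h2⟩ := key 1 (fun x hx => by rw [one_mul]; exact h x hx)
      rw [one_mul] at h1 h2
      exact mul_nonpos_of_nonpos_of_nonneg h1 h2
    · obtain ⟨h1, h2⟩ := key (-1) (fun x hx => by linarith [h x hx])
      exact mul_nonpos_of_nonneg_of_nonpos (by linarith) (by linarith)
  set F : ℝ → ℝ := fun z =>
    σ * (d * besselEven ν z - z ^ 2 / 2 * besselEven (ν + 1) z) * besselEven ν R -
      (d * besselEven ν R - R ^ 2 / 2 * besselEven (ν + 1) R) * besselEven ν z with hF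
  have hcF : Continuous F := by fun_prop
  have hFp : F p = -(σ * (p ^ 2 / 2) * besselEven ν R) * besselEven (ν + 1) p := by
    simp only [hF, hp]
    ring
  have hFq : F q = -(σ * (q ^ 2 / 2) * besselEven ν R) * besselEven (ν + 1) q := by
    simp only [hF, hq]
    ring
  have hprod : F p * F q < 0 := by
    have h1 : 0 < σ ^ 2 * (p ^ 2 / 2) * (q ^ 2 / 2) * besselEven ν R ^ 2 := by positivity
    rw [hFp, hFq]
    nlinarith [mul_pos_of_neg_of_neg (neg_neg_of_pos h1) hsign]
  by_contra! hno
  have hF0 : ∀ x ∈ Set.Ioo p q, F x ≠ 0 := fun x hx h => (hno x hx).2 (sub_eq_zero.1 h)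
  have hend : ∀ ε : ℝ, (∀ x ∈ Set.Ioo p q, 0 < ε * F x) → 0 ≤ ε * F p ∧ 0 ≤ ε * F q := by
    intro ε hε
    have hcl : IsClosed {x | 0 ≤ ε * F x} := isClosed_le continuous_const (by fun_prop)
    have : ∀ x ∈ Set.Icc p q, 0 ≤ ε * F x := by
      rw [← closure_Ioo hpq.ne]
      exact fun x hx => closure_minimal (fun y hy => (hε y hy).le) hcl hx
    exact ⟨this p ⟨le_rfl, hpq.le⟩, this q ⟨hpq.le, le_rfl⟩⟩
  rcases sign_const_of_ne_zero hcF hF0 with h | h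
  · obtain ⟨h1, h2⟩ := hend 1 (fun x hx => by rw [one_mul]; exact h x hx)
    nlinarith
  · obtain ⟨h1, h2⟩ := hend (-1) (fun x hx => by linarith [h x hx])
    nlinarith

end

/-- Take `a = (1 + δ/2)ν` and `c = √δ ν` in the Sturm bound: the hypothesis reduces to `1 + δ ≤ (1 +
δ/2)²`, and the factor `exp (π/c)^s` tends to `1` because `c → ∞`. -/
theorem eventually_besselZero_le (s : ℕ) {δ : ℝ} (hδ : 0 < δ) :
    ∀ᶠ ν in atTop, besselZero ν s ≤ (1 + δ) * ν := by
  have h1 : Tendsto (fun ν : ℝ => (1 + δ / 2) * Real.exp (Real.pi / (√δ * ν)) ^ s) atTop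
      (𝓝 ((1 + δ / 2) * Real.exp 0 ^ s)) := by
    have : Tendsto (fun ν : ℝ => Real.pi / (√δ * ν)) atTop (𝓝 0) :=
      tendsto_const_nhds.div_atTop (tendsto_id.const_mul_atTop (Real.sqrt_pos.2 hδ))
    exact ((Real.continuous_exp.continuousAt.tendsto.comp this).pow s).const_mul _
  rw [Real.exp_zero, one_pow, mul_one] at h1
  filter_upwards [h1.eventually_le_const (show 1 + δ / 2 < 1 + δ by linarith),
    eventually_gt_atTop 0] with ν hν h0
  have hs : √δ ^ 2 = δ := Real.sq_sqrt hδ.le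
  have hsp : 0 < √δ := Real.sqrt_pos.2 hδ
  have hq : ν ^ 2 + (√δ * ν) ^ 2 ≤ ((1 + δ / 2) * ν) ^ 2 := by
    rw [mul_pow, hs]
    nlinarith [sq_nonneg (δ * ν)]
  have := besselZero_le h0.le (a := (1 + δ / 2) * ν) (c := √δ * ν) (by positivity) (by positivity)
    hq s
  calc besselZero ν s ≤ _ := this
    _ = (1 + δ / 2) * Real.exp (Real.pi / (√δ * ν)) ^ s * ν := by ring
    _ ≤ _ := by gcongr


/-! ### Radial modes built from solid harmonics -/

section
variable {N : ℕ}

/-- The Laplacian in Cartesian coordinates. -/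
noncomputable def coordLaplacian (f : EuclideanSpace ℝ (Fin N) → ℂ)
    (x : EuclideanSpace ℝ (Fin N)) : ℂ :=
  ∑ i : Fin N, fderiv ℝ (fun y => fderiv ℝ f y (EuclideanSpace.single i 1)) x
    (EuclideanSpace.single i 1)

theorem laplacian_eq_coordLaplacian {f : EuclideanSpace ℝ (Fin N) → ℂ} (hf : ContDiff ℝ 2 f)
    (x : EuclideanSpace ℝ (Fin N)) : Laplacian.laplacian f x = coordLaplacian f x := by
  rw [InnerProductSpace.laplacian_eq_iteratedFDeriv_orthonormalBasis f
    (EuclideanSpace.basisFun (Fin N) ℝ)]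
  refine Finset.sum_congr rfl fun i _ => ?_
  have hd : DifferentiableAt ℝ (fderiv ℝ f) x :=
    ((hf.fderiv_right (m := 1) (by norm_num)).differentiable (by norm_num)).differentiableAt
  rw [iteratedFDeriv_two_apply, fderiv_clm_apply hd (differentiableAt_const _)]
  simp

theorem fderiv_const_mul_apply (c : ℂ) (g : EuclideanSpace ℝ (Fin N) → ℂ)
    (y v : EuclideanSpace ℝ (Fin N)) :
    fderiv ℝ (fun y => c * g y) y v = c * fderiv ℝ g y v := by
  change fderiv ℝ (c • g) y v = _
  rw [fderiv_const_smul_field c]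
  rfl

theorem divGrad_const (σ : ℝ) (w : EuclideanSpace ℝ (Fin N) → ℂ)
    (x : EuclideanSpace ℝ (Fin N)) :
    divGrad (fun _ => σ) w x = σ * coordLaplacian w x := by
  simp only [divGrad, coordLaplacian, Finset.mul_sum]
  refine Finset.sum_congr rfl fun i _ => ?_
  exact fderiv_const_mul_apply (σ : ℂ) (fun y => fderiv ℝ w y (EuclideanSpace.single i 1)) x _

theorem coordLaplacian_const_mul (c : ℂ) (w : EuclideanSpace ℝ (Fin N) → ℂ)
    (x : EuclideanSpace ℝ (Fin N)) :
    coordLaplacian (fun y => c * w y) x = c * coordLaplacian w x := by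
  simp only [coordLaplacian, Finset.mul_sum]
  refine Finset.sum_congr rfl fun i _ => ?_
  simp only [fderiv_const_mul_apply]

theorem hasFDerivAt_radial_mul {F : ℝ → ℝ} {F' : ℝ} {H : EuclideanSpace ℝ (Fin N) → ℂ}
    {y : EuclideanSpace ℝ (Fin N)} (hF : HasDerivAt F F' (‖y‖ ^ 2)) (hH : DifferentiableAt ℝ H y)
    (v : EuclideanSpace ℝ (Fin N)) :
    DifferentiableAt ℝ (fun x => (F (‖x‖ ^ 2) : ℂ) * H x) y ∧
    fderiv ℝ (fun x => (F (‖x‖ ^ 2) : ℂ) * H x) y v =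
      (F' : ℂ) * (((2 * inner ℝ y v : ℝ) : ℂ) * H y) + (F (‖y‖ ^ 2) : ℂ) * fderiv ℝ H y v := by
  have h1 := hF.comp_hasFDerivAt y (hasStrictFDerivAt_norm_sq y).hasFDerivAt
  have h2 := (Complex.ofRealCLM.hasFDerivAt.comp y h1).mul hH.hasFDerivAt
  refine ⟨h2.differentiableAt, ?_⟩
  have h3 : HasFDerivAt (fun x => (F (‖x‖ ^ 2) : ℂ) * H x) _ y := h2
  rw [h3.fderiv]
  simp
  ring

/-- Leibniz rule for `F(|x|²) H`. Writing the radial factor as a function of `|x|²` avoids the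
singularity of `|x|` at the origin. -/
theorem coordLaplacian_radial_mul {F F' F'' : ℝ → ℝ} {H : EuclideanSpace ℝ (Fin N) → ℂ}
    (hF : ∀ s, HasDerivAt F (F' s) s) (hF' : ∀ s, HasDerivAt F' (F'' s) s)
    (hH : ContDiff ℝ 2 H) (x : EuclideanSpace ℝ (Fin N)) :
    coordLaplacian (fun x => (F (‖x‖ ^ 2) : ℂ) * H x) x =
      ((4 * ‖x‖ ^ 2 * F'' (‖x‖ ^ 2) + 2 * N * F' (‖x‖ ^ 2) : ℝ) : ℂ) * H x +
        4 * (F' (‖x‖ ^ 2) : ℂ) * fderiv ℝ H x x + (F (‖x‖ ^ 2) : ℂ) * coordLaplacian H x := by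
  have hH1 : Differentiable ℝ H := hH.differentiable (by norm_num)
  have hd : ∀ v, Differentiable ℝ fun y => fderiv ℝ H y v := fun v =>
    ((hH.fderiv_right (m := 1) (by norm_num)).differentiable (by norm_num)).clm_apply
      (differentiable_const v)
  have hl : ∀ v, Differentiable ℝ fun y : EuclideanSpace ℝ (Fin N) =>
      ((2 * inner ℝ y v : ℝ) : ℂ) * H y := by
    intro v
    have : Differentiable ℝ fun y : EuclideanSpace ℝ (Fin N) => ((2 * inner ℝ y v : ℝ) : ℂ) :=
      Complex.ofRealCLM.differentiable.comp
        ((differentiable_id.inner ℝ (differentiable_const v)).const_mul 2)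
    exact this.mul hH1
  have hlv : ∀ v, fderiv ℝ (fun y : EuclideanSpace ℝ (Fin N) =>
      ((2 * inner ℝ y v : ℝ) : ℂ) * H y) x v =
      ((2 * inner ℝ v v : ℝ) : ℂ) * H x + ((2 * inner ℝ x v : ℝ) : ℂ) * fderiv ℝ H x v := by
    intro v
    have h1 : HasFDerivAt (fun y : EuclideanSpace ℝ (Fin N) => ((2 * inner ℝ v y : ℝ) : ℂ))
        (Complex.ofRealCLM.comp ((2 : ℝ) • innerSL ℝ v)) x :=
      (Complex.ofRealCLM.comp ((2 : ℝ) • innerSL ℝ v)).hasFDerivAt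
    simp only [real_inner_comm v]
    have h2 := h1.mul (hH1 x).hasFDerivAt
    have h3 : HasFDerivAt (fun y => ((2 * inner ℝ v y : ℝ) : ℂ) * H y) _ x := h2
    rw [h3.fderiv]
    simp
    ring
  have key : ∀ v, fderiv ℝ (fun y => fderiv ℝ (fun x => (F (‖x‖ ^ 2) : ℂ) * H x) y v) x v =
      ((4 * inner ℝ x v ^ 2 * F'' (‖x‖ ^ 2) + 2 * inner ℝ v v * F' (‖x‖ ^ 2) : ℝ) : ℂ) * H x +
      4 * (F' (‖x‖ ^ 2) : ℂ) * ((inner ℝ x v : ℝ) * fderiv ℝ H x v) +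
      (F (‖x‖ ^ 2) : ℂ) * fderiv ℝ (fun y => fderiv ℝ H y v) x v := by
    intro v
    have e : (fun y => fderiv ℝ (fun x => (F (‖x‖ ^ 2) : ℂ) * H x) y v) = fun y =>
        (F' (‖y‖ ^ 2) : ℂ) * (((2 * inner ℝ y v : ℝ) : ℂ) * H y) +
          (F (‖y‖ ^ 2) : ℂ) * fderiv ℝ H y v :=
      funext fun y => (hasFDerivAt_radial_mul (hF _) (hH1 y) v).2
    rw [e]
    obtain ⟨a1, a2⟩ := hasFDerivAt_radial_mul (hF' (‖x‖ ^ 2)) (hl v x) v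
    obtain ⟨b1, b2⟩ := hasFDerivAt_radial_mul (hF (‖x‖ ^ 2)) (hd v x) v
    rw [fderiv_fun_add a1 b1, add_apply, a2, b2, hlv]
    push_cast
    ring
  have hsq : ∑ i : Fin N, inner ℝ x (EuclideanSpace.single i (1 : ℝ)) ^ 2 = ‖x‖ ^ 2 := by
    rw [EuclideanSpace.norm_sq_eq]
    simp [EuclideanSpace.inner_single_right]
  have hE : ∑ i : Fin N, ((inner ℝ x (EuclideanSpace.single i (1 : ℝ)) : ℝ) : ℂ) *
      fderiv ℝ H x (EuclideanSpace.single i 1) = fderiv ℝ H x x := by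
    have hx : x = ∑ i : Fin N, (inner ℝ x (EuclideanSpace.single i (1 : ℝ))) •
        EuclideanSpace.single i (1 : ℝ) := by
      have := (EuclideanSpace.basisFun (Fin N) ℝ).sum_repr' x
      simpa [EuclideanSpace.inner_single_left, EuclideanSpace.inner_single_right] using this.symm
    conv_rhs => rw [hx, map_sum]
    refine Finset.sum_congr rfl fun i _ => ?_
    conv_rhs => rw [map_smul, Complex.real_smul]
    rw [← hx]
  have h1 : ∀ i : Fin N, inner ℝ (EuclideanSpace.single i (1 : ℝ))
      (EuclideanSpace.single i (1 : ℝ)) = (1 : ℝ) := by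
    intro i
    simp
  simp only [coordLaplacian, key, Finset.sum_add_distrib, ← Finset.mul_sum, ← Finset.sum_mul,
    hE, h1]
  congr 3
  rw [← Complex.ofReal_sum, Finset.sum_add_distrib, ← Finset.sum_mul, ← Finset.mul_sum, hsq]
  simp
  ring

/-- A nonzero harmonic function that is positively homogeneous of degree `d`. -/
structure IsSolidHarmonic (d : ℕ) (H : EuclideanSpace ℝ (Fin N) → ℂ) : Prop where
  contDiff : ContDiff ℝ 2 H
  homogeneous : ∀ (t : ℝ) (x : EuclideanSpace ℝ (Fin N)), 0 < t → H (t • x) = (t : ℂ) ^ d * H x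
  harmonic : ∀ x, coordLaplacian H x = 0
  exists_ne_zero : ∃ x, H x ≠ 0

/-- Euler's identity, from differentiating `H(tx) = t^d H(x)` at `t = 1`. -/
theorem fderiv_self_of_homogeneous {d : ℕ} {H : EuclideanSpace ℝ (Fin N) → ℂ}
    {x : EuclideanSpace ℝ (Fin N)} (hd : DifferentiableAt ℝ H x)
    (hH : ∀ t : ℝ, 0 < t → H (t • x) = (t : ℂ) ^ d * H x) :
    fderiv ℝ H x x = d * H x := by
  have h1 : HasDerivAt (fun t : ℝ => t • x) x 1 := by
    simpa using (hasDerivAt_id (1 : ℝ)).smul_const x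
  have hd' : HasFDerivAt H (fderiv ℝ H x) ((1 : ℝ) • x) := by rw [one_smul]; exact hd.hasFDerivAt
  have h2 := hd'.comp_hasDerivAt (1 : ℝ) h1
  have h3 : HasDerivAt (fun t : ℝ => (t : ℂ) ^ d * H x) (d * H x) 1 := by
    have := ((hasDerivAt_id (1 : ℝ)).ofReal_comp.fun_pow d).mul_const (H x)
    convert! this using 1
    simp
  refine h2.unique (h3.congr_of_eventuallyEq ?_)
  filter_upwards [lt_mem_nhds (show (0 : ℝ) < 1 by norm_num)] with t ht using hH t ht

/-- The function `Φ_ν((κ|x|/2)²) H(x)`. -/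
noncomputable def radialMode (ν : ℝ) (H : EuclideanSpace ℝ (Fin N) → ℂ) (κ : ℝ)
    (x : EuclideanSpace ℝ (Fin N)) : ℂ :=
  (besselEven ν (κ * ‖x‖) : ℂ) * H x

theorem radialMode_eq (ν : ℝ) (H : EuclideanSpace ℝ (Fin N) → ℂ) (κ : ℝ) :
    radialMode ν H κ = fun x => (besselSeries ν (κ ^ 2 / 4 * ‖x‖ ^ 2) : ℂ) * H x := by
  funext x
  rw [radialMode, besselEven]
  congr 3
  ring

theorem hasDerivAt_besselSeries_scale {ν : ℝ} (hν : 0 ≤ ν) (c s : ℝ) :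
    HasDerivAt (fun s => besselSeries ν (c * s)) (-c * besselSeries (ν + 1) (c * s)) s := by
  have := (hasDerivAt_besselSeries hν (c * s)).comp s ((hasDerivAt_id s).const_mul c)
  convert! this using 1
  ring

section
variable {ν : ℝ} {d : ℕ} {H : EuclideanSpace ℝ (Fin N) → ℂ} (hν : 0 ≤ ν)
  (hH : IsSolidHarmonic d H)
include hν hH

theorem contDiff_radialMode (κ : ℝ) : ContDiff ℝ 2 (radialMode ν H κ) := by
  rw [radialMode_eq]
  have h1 : ContDiff ℝ 2 (besselSeries ν) := contDiff_besselSeries 2 hν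
  have h2 : ContDiff ℝ 2 fun x : EuclideanSpace ℝ (Fin N) =>
      besselSeries ν (κ ^ 2 / 4 * ‖x‖ ^ 2) :=
    h1.comp (contDiff_const.mul (contDiff_norm_sq ℝ))
  exact (Complex.ofRealCLM.contDiff.comp h2).mul hH.contDiff

/-- With `ΔH = 0` and Euler's identity, the radial factor must satisfy `sF'' + (d + N/2)F' + (κ²/4)F
= 0`; this is the rescaled recurrence exactly because `ν + 1 = d + N/2`. -/
theorem radialMode_helmholtz (hdN : ν + 1 = d + N / 2) (κ : ℝ) (x : EuclideanSpace ℝ (Fin N)) :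
    coordLaplacian (radialMode ν H κ) x + (κ : ℂ) ^ 2 * radialMode ν H κ x = 0 := by
  rw [radialMode_eq]
  have hF := hasDerivAt_besselSeries_scale hν (κ ^ 2 / 4)
  have hF' : ∀ s, HasDerivAt (fun s => -(κ ^ 2 / 4) * besselSeries (ν + 1) (κ ^ 2 / 4 * s))
      ((κ ^ 2 / 4) ^ 2 * besselSeries (ν + 2) (κ ^ 2 / 4 * s)) s := by
    intro s
    have := (hasDerivAt_besselSeries_scale (ν := ν + 1) (by positivity) (κ ^ 2 / 4) s).const_mul
      (-(κ ^ 2 / 4))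
    convert! this using 1
    rw [show ν + 1 + 1 = ν + 2 by ring]
    ring
  rw [coordLaplacian_radial_mul hF hF' hH.contDiff x, hH.harmonic x,
    fderiv_self_of_homogeneous (hH.contDiff.differentiable (by norm_num) x)
      fun t ht => hH.homogeneous t x ht]
  have hr := besselSeries_recurrence hν (κ ^ 2 / 4 * ‖x‖ ^ 2)
  have hrC := congrArg (fun t : ℝ => (t : ℂ)) hr
  have hdC := congrArg (fun t : ℝ => (t : ℂ)) hdN
  push_cast at hrC hdC ⊢
  rw [hdC] at hrC
  linear_combination (κ : ℂ) ^ 2 * H x * hrC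

theorem normalDeriv_radialMode {r₀ : ℝ} (hr₀ : 0 < r₀) (c : ℂ) (κ : ℝ)
    {x : EuclideanSpace ℝ (Fin N)} (hx : x ∈ sphere (0 : EuclideanSpace ℝ (Fin N)) r₀) :
    normalDeriv r₀ (fun x => c * radialMode ν H κ x) x =
      c * ((d * besselEven ν (κ * r₀) -
        (κ * r₀) ^ 2 / 2 * besselEven (ν + 1) (κ * r₀) : ℝ) : ℂ) * H x / r₀ := by
  have hxn : ‖x‖ = r₀ := by simpa using hx
  have hdiff : Differentiable ℝ (radialMode ν H κ) :=
    (contDiff_radialMode hν hH κ).differentiable (by norm_num)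
  have hu : UniqueDiffWithinAt ℝ (closedBall (0 : EuclideanSpace ℝ (Fin N)) r₀) x := by
    refine uniqueDiffWithinAt_convex (convex_closedBall 0 r₀) ?_ ?_
    · exact ⟨0, mem_interior_iff_mem_nhds.2 (closedBall_mem_nhds 0 hr₀)⟩
    · exact subset_closure (sphere_subset_closedBall hx)
  have hF := hasDerivAt_besselSeries_scale hν (κ ^ 2 / 4) (‖x‖ ^ 2)
  have h1 := (hasFDerivAt_radial_mul hF (hH.contDiff.differentiable (by norm_num) x) x).2
  rw [fderiv_self_of_homogeneous (hH.contDiff.differentiable (by norm_num) x)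
      fun t ht => hH.homogeneous t x ht, ← radialMode_eq, real_inner_self_eq_norm_sq, hxn] at h1
  rw [normalDeriv, fderivWithin_eq_fderiv hu ((hdiff x).const_mul c), fderiv_const_mul (hdiff x),
    map_smul, smul_apply, h1]
  have e : κ ^ 2 / 4 * r₀ ^ 2 = (κ * r₀ / 2) ^ 2 := by ring
  have hrC : (r₀ : ℂ) ≠ 0 := by exact_mod_cast hr₀.ne'
  rw [e]
  simp only [besselEven, smul_eq_mul, Complex.real_smul]
  push_cast
  field_simp
  ring

theorem exists_radialMode_ne_zero {r₀ : ℝ} (hr₀ : 0 < r₀) (κ : ℝ) :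
    ∃ x ∈ ball (0 : EuclideanSpace ℝ (Fin N)) r₀, radialMode ν H κ x ≠ 0 := by
  obtain ⟨x, hx⟩ := hH.exists_ne_zero
  have c1 : ContinuousAt (fun t : ℝ => besselEven ν (κ * ‖t • x‖)) 0 := by
    have := continuous_besselEven hν
    fun_prop
  have c2 : ContinuousAt (fun t : ℝ => ‖t • x‖) 0 := by fun_prop
  have e1 : ∀ᶠ t in 𝓝 (0 : ℝ), besselEven ν (κ * ‖t • x‖) ≠ 0 :=
    c1.eventually_ne (by simpa using (besselEven_zero_pos hν).ne')
  have e2 : ∀ᶠ t in 𝓝 (0 : ℝ), ‖t • x‖ < r₀ :=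
    c2.eventually_lt continuousAt_const (by simpa using hr₀)
  obtain ⟨t, ⟨h1, h2⟩, ht⟩ := (((e1.and e2).filter_mono nhdsWithin_le_nhds).and
    (self_mem_nhdsWithin (s := Set.Ioi (0 : ℝ)))).exists
  have ht : 0 < t := ht
  refine ⟨t • x, by simpa using h2, ?_⟩
  rw [radialMode, hH.homogeneous t x ht]
  have : (t : ℂ) ≠ 0 := by exact_mod_cast ht.ne'
  exact mul_ne_zero (by exact_mod_cast h1) (mul_ne_zero (pow_ne_zero _ this) hx)

/-- The transmission conditions for two radial modes reduce to two scalar equations. -/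
theorem isTransmissionEigenpair_radialMode (hdN : ν + 1 = d + N / 2) {r₀ k σ n : ℝ} (hr₀ : 0 < r₀)
    {α β : ℂ} (hβ : β ≠ 0)
    (hdir : α * (besselEven ν (k * n * r₀) : ℂ) = β * (besselEven ν (k * r₀) : ℂ))
    (hneu : σ * (α * ((d * besselEven ν (k * n * r₀) -
        (k * n * r₀) ^ 2 / 2 * besselEven (ν + 1) (k * n * r₀) : ℝ) : ℂ)) =
      β * ((d * besselEven ν (k * r₀) - (k * r₀) ^ 2 / 2 * besselEven (ν + 1) (k * r₀) : ℝ) : ℂ)) :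
    IsTransmissionEigenpair r₀ (fun _ => σ) (fun _ => σ * n ^ 2) k
      (fun x => β * radialMode ν H k x) (fun x => α * radialMode ν H (k * n) x) where
  v_interior := (contDiff_const.mul (contDiff_radialMode hν hH k)).contDiffOn
  w_interior := (contDiff_const.mul (contDiff_radialMode hν hH (k * n))).contDiffOn
  v_closure := ((contDiff_const.mul (contDiff_radialMode hν hH k)).of_le (by norm_num)).contDiffOn
  w_closure :=
    ((contDiff_const.mul (contDiff_radialMode hν hH (k * n))).of_le (by norm_num)).contDiffOn
  w_eq x _ := by
    rw [divGrad_const, coordLaplacian_const_mul]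
    have := radialMode_helmholtz hν hH hdN (k * n) x
    push_cast at this ⊢
    linear_combination (σ : ℂ) * α * this
  v_eq x _ := by
    rw [laplacian_eq_coordLaplacian (contDiff_const.mul (contDiff_radialMode hν hH k)),
      coordLaplacian_const_mul]
    linear_combination β * radialMode_helmholtz hν hH hdN k x
  dirichlet x hx := by
    have hxn : ‖x‖ = r₀ := by simpa using hx
    simp only [radialMode, hxn]
    linear_combination H x * hdir
  neumann x hx := by
    rw [normalDeriv_radialMode hν hH hr₀ α (k * n) hx, normalDeriv_radialMode hν hH hr₀ β k hx]
    linear_combination H x / r₀ * hneu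
  nontrivial := by
    obtain ⟨x, hx, h⟩ := exists_radialMode_ne_zero hν hH hr₀ k
    exact ⟨x, hx, Or.inl (mul_ne_zero hβ h)⟩

end

end


/-! ### Surface localization -/

section
variable {N : ℕ}

theorem memLp_restrict_of_continuous {f : EuclideanSpace ℝ (Fin N) → ℂ} (hf : Continuous f)
    {A : Set (EuclideanSpace ℝ (Fin N))} {r : ℝ} (hA : A ⊆ closedBall 0 r) :
    MemLp f 2 (volume.restrict A) := by
  have hfin : IsFiniteMeasure (volume.restrict (closedBall (0 : EuclideanSpace ℝ (Fin N)) r)) :=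
    isFiniteMeasure_restrict.2 (isCompact_closedBall 0 r).measure_lt_top.ne
  obtain ⟨C, hC⟩ := (isCompact_closedBall (0 : EuclideanSpace ℝ (Fin N)) r).exists_bound_of_continuousOn
    hf.continuousOn
  have : MemLp f 2 (volume.restrict (closedBall (0 : EuclideanSpace ℝ (Fin N)) r)) :=
    MemLp.of_bound hf.aestronglyMeasurable C
      ((ae_restrict_iff' measurableSet_closedBall).2 (Eventually.of_forall hC))
  exact this.mono_measure (Measure.restrict_mono hA le_rfl)

theorem l2Norm_mono {f : EuclideanSpace ℝ (Fin N) → ℂ} (hf : Continuous f)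
    {A B : Set (EuclideanSpace ℝ (Fin N))} {r : ℝ} (hAB : A ⊆ B) (hB : B ⊆ closedBall 0 r) :
    l2Norm A f ≤ l2Norm B f :=
  ENNReal.toReal_mono (memLp_restrict_of_continuous hf hB).2.ne
    (eLpNorm_mono_measure f (Measure.restrict_mono hAB le_rfl))

theorem l2Norm_eq_sqrt {f : EuclideanSpace ℝ (Fin N) → ℂ} (hf : Continuous f)
    {A : Set (EuclideanSpace ℝ (Fin N))} {r : ℝ} (hA : A ⊆ closedBall 0 r) :
    l2Norm A f = √(∫ x in A, ‖f x‖ ^ 2) := by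
  rw [l2Norm, (memLp_restrict_of_continuous hf hA).eLpNorm_eq_integral_rpow_norm
    (by norm_num) (by norm_num), ENNReal.toReal_ofReal (by positivity), Real.sqrt_eq_rpow]
  norm_num

theorem l2Norm_pos {f : EuclideanSpace ℝ (Fin N) → ℂ} (hf : Continuous f) {r : ℝ}
    (h : ∃ x ∈ ball (0 : EuclideanSpace ℝ (Fin N)) r, f x ≠ 0) : 0 < l2Norm (ball 0 r) f := by
  have hm := memLp_restrict_of_continuous hf (ball_subset_closedBall (x := 0) (ε := r))
  refine ENNReal.toReal_pos (fun h0 => ?_) hm.2.ne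
  rw [eLpNorm_eq_zero_iff hm.1 (by norm_num)] at h0
  obtain ⟨x, hx, hne⟩ := h
  exact hne (Measure.eqOn_open_of_ae_eq h0 isOpen_ball hf.continuousOn continuousOn_const hx)

/-- If a dilation by `η` shrinks the values of `f` on a ball by the factor `C`, then the `L²` norm
over the shrunk ball is smaller by the same factor. -/
theorem l2Norm_dilate_le {f : EuclideanSpace ℝ (Fin N) → ℂ} (hf : Continuous f) {η C r : ℝ}
    (hη : 0 < η) (hη1 : η ≤ 1) (hC : 0 ≤ C)
    (h : ∀ x ∈ closedBall (0 : EuclideanSpace ℝ (Fin N)) r, ‖f (η • x)‖ ≤ C * ‖f x‖) :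
    l2Norm (closedBall 0 (η * r)) f ≤ C * l2Norm (closedBall 0 r) f := by
  rw [l2Norm_eq_sqrt hf le_rfl, l2Norm_eq_sqrt hf le_rfl]
  have e : ∫ x in closedBall (0 : EuclideanSpace ℝ (Fin N)) (η * r), ‖f x‖ ^ 2 =
      η ^ N * ∫ x in closedBall (0 : EuclideanSpace ℝ (Fin N)) r, ‖f (η • x)‖ ^ 2 := by
    have := Measure.setIntegral_comp_smul_of_pos volume (fun x => ‖f x‖ ^ 2)
      (closedBall (0 : EuclideanSpace ℝ (Fin N)) r) hη
    rw [this, smul_closedBall' hη.ne', smul_zero, Real.norm_of_nonneg hη.le, finrank_euclideanSpace_fin,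
      smul_eq_mul, mul_inv_cancel_left₀ (by positivity)]
  have hi : ∀ g : EuclideanSpace ℝ (Fin N) → ℝ, Continuous g →
      IntegrableOn g (closedBall 0 r) := fun g hg =>
    hg.continuousOn.integrableOn_compact (isCompact_closedBall 0 r)
  have h1 : ∫ x in closedBall (0 : EuclideanSpace ℝ (Fin N)) r, ‖f (η • x)‖ ^ 2 ≤
      ∫ x in closedBall (0 : EuclideanSpace ℝ (Fin N)) r, C ^ 2 * ‖f x‖ ^ 2 := by
    refine setIntegral_mono_on (hi _ (by fun_prop)) (hi _ (by fun_prop))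
      measurableSet_closedBall fun x hx => ?_
    rw [← mul_pow]
    exact pow_le_pow_left₀ (norm_nonneg _) (h x hx) 2
  have h0 : 0 ≤ ∫ x in closedBall (0 : EuclideanSpace ℝ (Fin N)) r, ‖f (η • x)‖ ^ 2 :=
    integral_nonneg fun x => by positivity
  have h2 : η ^ N ≤ 1 := pow_le_one₀ hη.le hη1
  rw [integral_const_mul] at h1
  calc √(∫ x in closedBall (0 : EuclideanSpace ℝ (Fin N)) (η * r), ‖f x‖ ^ 2)
      ≤ √(C ^ 2 * ∫ x in closedBall (0 : EuclideanSpace ℝ (Fin N)) r, ‖f x‖ ^ 2) := by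
        refine Real.sqrt_le_sqrt ?_
        rw [e]
        exact (mul_le_of_le_one_left h0 h2).trans h1
    _ = _ := by rw [Real.sqrt_mul (by positivity), Real.sqrt_sq hC]

/-- Radial projection gives a boundary point at distance `r - |x|`. At the centre any boundary point
serves, and its existence needs `N ≠ 0`. -/
theorem innerPart_ball_subset [NeZero N] {r ε : ℝ} (hr : 0 < r) :
    innerPart (ball (0 : EuclideanSpace ℝ (Fin N)) r) ε ⊆ closedBall 0 (r - ε) := by
  rintro x ⟨hx, hε⟩
  rw [frontier_ball _ hr.ne'] at hε
  obtain ⟨y, hy1, hy2⟩ : ∃ y : EuclideanSpace ℝ (Fin N), ‖y‖ = r ∧ ‖x - y‖ = r - ‖x‖ := by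
    by_cases h0 : x = 0
    · refine ⟨EuclideanSpace.single 0 r, ?_, ?_⟩
      · simp [abs_of_pos hr]
      · simp [h0, abs_of_pos hr]
    · have hn : 0 < ‖x‖ := norm_pos_iff.2 h0
      have hxr : ‖x‖ < r := by simpa using hx
      have h1 : 1 < r / ‖x‖ := (one_lt_div hn).2 hxr
      refine ⟨(r / ‖x‖) • x, ?_, ?_⟩
      · rw [norm_smul, Real.norm_of_nonneg (by positivity), div_mul_cancel₀ _ hn.ne']
      · have : x - (r / ‖x‖) • x = (1 - r / ‖x‖) • x := by module
        rw [this, norm_smul, Real.norm_of_nonpos (by linarith)]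
        field_simp
        ring
  have h2 : infDist x (sphere 0 r) ≤ dist x y := infDist_le_dist_of_mem (by simpa using hy1)
  rw [dist_eq_norm, hy2] at h2
  rw [mem_closedBall_zero_iff]
  linarith

theorem besselEven_dilate_le {ν η y : ℝ} (hν : 0 ≤ ν) (hη0 : 0 < η) (hη1 : η < 1) (hy : 0 ≤ y)
    (hyν : y < ν) :
    (ν ^ 2 - y ^ 2) * (1 - η) ^ 2 / 2 * (η ^ ν * besselEven ν (η * y)) ≤ besselEven ν y := by
  have hpos : ∀ t : ℝ, 0 < t → t < ν →
      (ν ^ 2 - t ^ 2) * (1 - η) ^ 2 / 2 * (η ^ ν * besselEven ν (η * t)) ≤ besselEven ν t := by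
    intro t ht htν
    have h := scaledBessel_growth hν hη0 hη1 ht htν
    have hp := Real.rpow_pos_of_pos ht ν
    rw [scaledBessel, scaledBessel, Real.mul_rpow hη0.le ht.le] at h
    refine le_of_mul_le_mul_left ?_ hp
    linarith
  rcases hy.eq_or_lt with rfl | hy'
  · have hc := continuous_besselEven hν
    have h1 : Continuous fun t =>
        (ν ^ 2 - t ^ 2) * (1 - η) ^ 2 / 2 * (η ^ ν * besselEven ν (η * t)) := by fun_prop
    refine le_of_tendsto_of_tendsto (h1.continuousAt.continuousWithinAt (s := Set.Ioi 0))
      (hc.continuousAt.continuousWithinAt (s := Set.Ioi 0)) ?_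
    filter_upwards [Ioo_mem_nhdsGT hyν] with t ht using hpos t ht.1 ht.2
  · exact hpos y hy' hyν

/-- Choose `η < 1` so that the inner part lies in the ball of radius `η² r₀`. Dilation by `η` maps
the ball of radius `η r₀` onto that one and shrinks the mode by a factor `O(ν⁻²)`, since the
arguments there stay below a fixed fraction of the order. -/
theorem surfaceLocalized_radialMode [NeZero N] {r₀ : ℝ} (hr₀ : 0 < r₀) {ν κ : ℕ → ℝ} {a : ℝ}
    (hν : ∀ m, 0 ≤ ν m) (hνm : ∀ m, ν m = m + a)
    {H : ℕ → EuclideanSpace ℝ (Fin N) → ℂ} (hH : ∀ m, IsSolidHarmonic m (H m))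
    (hκ : ∀ m, 0 ≤ κ m) (hκν : ∀ δ > 0, ∀ᶠ m in atTop, κ m * r₀ ≤ (1 + δ) * ν m)
    {γ : ℕ → ℂ} (hγ : ∀ m, γ m ≠ 0) :
    SurfaceLocalized (ball 0 r₀) (fun m x => γ m * radialMode (ν m) (H m) (κ m) x) := by
  have hcont : ∀ m, Continuous fun x => γ m * radialMode (ν m) (H m) (κ m) x := fun m =>
    continuous_const.mul (contDiff_radialMode (hν m) (hH m) (κ m)).continuous
  have hpos : ∀ m, 0 < l2Norm (ball 0 r₀) fun x => γ m * radialMode (ν m) (H m) (κ m) x := by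
    intro m
    obtain ⟨x, hx, h⟩ := exists_radialMode_ne_zero (hν m) (hH m) hr₀ (κ m)
    exact l2Norm_pos (hcont m) ⟨x, hx, mul_ne_zero (hγ m) h⟩
  refine ⟨fun m => ⟨memLp_restrict_of_continuous (hcont m) ball_subset_closedBall, hpos m⟩, ?_⟩
  intro ε hε
  obtain ⟨η, hη0, hη1, hηr⟩ : ∃ η : ℝ, 0 < η ∧ η < 1 ∧ r₀ - ε ≤ η * (η * r₀) := by
    -- `η = √q` gives `η² r₀ ≥ r₀ - ε`; the maximum with `1/2` keeps `η` positive when `ε ≥ r₀`.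
    set q := max (1 / 2) (1 - ε / r₀) with hq
    have hq0 : 0 < q := lt_max_of_lt_left (by norm_num)
    have hq1 : q < 1 := max_lt (by norm_num) (by linarith [div_pos hε hr₀])
    refine ⟨√q, Real.sqrt_pos.2 hq0, (Real.sqrt_lt' one_pos).2 (by simpa using hq1), ?_⟩
    rw [← mul_assoc, Real.mul_self_sqrt hq0.le]
    have : (1 - ε / r₀) * r₀ ≤ q * r₀ := by gcongr; exact le_max_right _ _
    have e : (1 - ε / r₀) * r₀ = r₀ - ε := by field_simp
    linarith
  -- With `δ = 1 - η`, points of the ball of radius `η r₀` have `κ|x| ≤ η(1 + δ)ν = ρν`, and `ρ = 1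
  -- - (1 - η)² < 1`.
  set ρ := η * (2 - η) with hρ
  have hρ0 : 0 < ρ := mul_pos hη0 (by linarith)
  have hρ1 : ρ < 1 := by nlinarith [sq_pos_of_pos (sub_pos.2 hη1)]
  set c := (1 - ρ ^ 2) * (1 - η) ^ 2 / 2 with hc
  have hc0 : 0 < c := by
    have h1 : 0 < 1 - ρ ^ 2 := by nlinarith
    have h2 : 0 < 1 - η := sub_pos.2 hη1
    positivity
  have hνlim : Tendsto ν atTop atTop := by
    rw [funext hνm]
    exact tendsto_atTop_add_const_right _ _ tendsto_natCast_atTop_atTop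
  have hlim : Tendsto (fun m => η ^ (-a) / (c * ν m ^ 2)) atTop (𝓝 0) :=
    tendsto_const_nhds.div_atTop
      (((tendsto_pow_atTop two_ne_zero).comp hνlim).const_mul_atTop hc0)
  refine squeeze_zero' (Eventually.of_forall fun m => div_nonneg ENNReal.toReal_nonneg
    ENNReal.toReal_nonneg) ?_ hlim
  filter_upwards [hκν (1 - η) (sub_pos.2 hη1), hνlim.eventually_gt_atTop 0] with m hm hν0
  rw [div_le_iff₀ (hpos m)]
  have hC : 0 ≤ η ^ (-a) / (c * ν m ^ 2) := by positivity
  refine (l2Norm_mono (hcont m) ((innerPart_ball_subset hr₀).trans (closedBall_subset_closedBall hηr))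
    le_rfl).trans ((l2Norm_dilate_le (hcont m) hη0 hη1.le hC ?_).trans
      (mul_le_mul_of_nonneg_left (l2Norm_mono (hcont m)
        (closedBall_subset_ball (mul_lt_of_lt_one_left hr₀ hη1)) ball_subset_closedBall) hC))
  intro x hx
  have hxn : ‖x‖ ≤ η * r₀ := by simpa using hx
  set y := κ m * ‖x‖ with hy
  have hy0 : 0 ≤ y := mul_nonneg (hκ m) (norm_nonneg x)
  have hyρ : y ≤ ρ * ν m := by
    calc y ≤ κ m * (η * r₀) := mul_le_mul_of_nonneg_left hxn (hκ m)
      _ = η * (κ m * r₀) := by ring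
      _ ≤ η * ((1 + (1 - η)) * ν m) := by gcongr
      _ = ρ * ν m := by rw [hρ]; ring
  have hyν : y < ν m := hyρ.trans_lt (mul_lt_of_lt_one_left hν0 hρ1)
  have hg := besselEven_dilate_le (hν m) hη0 hη1 hy0 hyν
  have hφ : 0 < besselEven (ν m) (η * y) :=
    besselEven_pos (hν m) (by positivity) ((mul_le_of_le_one_left hy0 hη1.le).trans hyν.le)
  have hφy : 0 < besselEven (ν m) y := besselEven_pos (hν m) hy0 hyν.le
  -- The solid harmonic scales with degree `m` and the growth estimate with order `ν = m + a`; the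
  -- discrepancy is a constant independent of `m`.
  have hηm : η ^ (ν m) = η ^ m / η ^ (-a) := by
    rw [hνm, Real.rpow_add hη0, Real.rpow_natCast, Real.rpow_neg hη0.le, div_inv_eq_mul]
  have hηa : 0 < η ^ (-a) := Real.rpow_pos_of_pos hη0 _
  have hbound : η ^ m * besselEven (ν m) (η * y) ≤
      η ^ (-a) / (c * ν m ^ 2) * besselEven (ν m) y := by
    have h1 : c * ν m ^ 2 ≤ (ν m ^ 2 - y ^ 2) * (1 - η) ^ 2 / 2 := by
      have : y ^ 2 ≤ (ρ * ν m) ^ 2 := pow_le_pow_left₀ hy0 hyρ 2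
      rw [hc]
      nlinarith [sq_nonneg (1 - η)]
    have h2 := (mul_le_mul_of_nonneg_right h1 (show 0 ≤ η ^ (ν m) * besselEven (ν m) (η * y) by
      positivity)).trans hg
    rw [hηm] at h2
    rw [div_mul_eq_mul_div, le_div_iff₀ (by positivity)]
    calc η ^ m * besselEven (ν m) (η * y) * (c * ν m ^ 2)
        = η ^ (-a) * (c * ν m ^ 2 * (η ^ m / η ^ (-a) * besselEven (ν m) (η * y))) := by
          field_simp
      _ ≤ _ := by gcongr
  have e1 : κ m * ‖η • x‖ = η * y := by
    rw [norm_smul, Real.norm_of_nonneg hη0.le, hy]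
    ring
  simp only [radialMode, e1, ← hy, (hH m).homogeneous η x hη0, norm_mul, norm_pow, Complex.norm_real,
    Real.norm_of_nonneg hη0.le, Real.norm_of_nonneg hφ.le, Real.norm_of_nonneg hφy.le]
  calc ‖γ m‖ * (besselEven (ν m) (η * y) * (η ^ m * ‖H m x‖))
      = ‖γ m‖ * ‖H m x‖ * (η ^ m * besselEven (ν m) (η * y)) := by ring
    _ ≤ ‖γ m‖ * ‖H m x‖ * (η ^ (-a) / (c * ν m ^ 2) * besselEven (ν m) y) := by gcongr
    _ = _ := by ring

end


/-! ### Monomials in two linear forms -/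

section
variable {N : ℕ} (L₁ L₂ : EuclideanSpace ℝ (Fin N) →L[ℝ] ℂ)

theorem coordLaplacian_sum {ι : Type*} (s : Finset ι) {f : ι → EuclideanSpace ℝ (Fin N) → ℂ}
    (hf : ∀ i, ContDiff ℝ 2 (f i)) (x : EuclideanSpace ℝ (Fin N)) :
    coordLaplacian (fun y => ∑ i ∈ s, f i y) x = ∑ i ∈ s, coordLaplacian (f i) x := by
  have h1 : ∀ i, Differentiable ℝ (f i) := fun i => (hf i).differentiable (by norm_num)
  have h2 : ∀ i v, Differentiable ℝ fun y => fderiv ℝ (f i) y v := fun i v =>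
    (((hf i).fderiv_right (m := 1) (by norm_num)).differentiable (by norm_num)).clm_apply
      (differentiable_const v)
  have e : ∀ y v, fderiv ℝ (fun y => ∑ i ∈ s, f i y) y v = ∑ i ∈ s, fderiv ℝ (f i) y v := by
    intro y v
    rw [fderiv_fun_sum fun i _ => h1 i y]
    simp
  simp only [coordLaplacian, e]
  rw [Finset.sum_comm]
  refine Finset.sum_congr rfl fun j _ => ?_
  rw [fderiv_fun_sum fun i _ => h2 i _ x]
  simp

/-- The monomial `L₁^p L₂^q` in two complex linear forms. -/
noncomputable def formMonomial (p q : ℕ) (x : EuclideanSpace ℝ (Fin N)) : ℂ := L₁ x ^ p * L₂ x ^ q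

theorem contDiff_formMonomial (p q : ℕ) : ContDiff ℝ 2 (formMonomial L₁ L₂ p q) :=
  (L₁.contDiff.pow p).mul (L₂.contDiff.pow q)

theorem formMonomial_smul (p q : ℕ) (t : ℝ) (x : EuclideanSpace ℝ (Fin N)) :
    formMonomial L₁ L₂ p q (t • x) = (t : ℂ) ^ (p + q) * formMonomial L₁ L₂ p q x := by
  simp only [formMonomial, map_smul, Complex.real_smul]
  ring

theorem fderiv_formMonomial (p q : ℕ) (y v : EuclideanSpace ℝ (Fin N)) :
    fderiv ℝ (formMonomial L₁ L₂ p q) y v =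
      p * L₁ v * formMonomial L₁ L₂ (p - 1) q y + q * L₂ v * formMonomial L₁ L₂ p (q - 1) y := by
  have h : HasFDerivAt (formMonomial L₁ L₂ p q) _ y :=
    (L₁.hasFDerivAt.pow p).mul (L₂.hasFDerivAt.pow q)
  rw [h.fderiv]
  simp [formMonomial]
  ring

/-- The bilinear products `∇L₁·∇L₁` and `∇L₁·∇L₂` vanish, so only the second derivative in `L₂`
survives. For `L₁ = x ± iy` and `L₂ = z` this gives the building blocks of spherical harmonics. -/
theorem coordLaplacian_formMonomial
    (h₁₁ : ∑ i, L₁ (EuclideanSpace.single i 1) ^ 2 = 0)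
    (h₁₂ : ∑ i, L₁ (EuclideanSpace.single i 1) * L₂ (EuclideanSpace.single i 1) = 0)
    (p q : ℕ) (x : EuclideanSpace ℝ (Fin N)) :
    coordLaplacian (formMonomial L₁ L₂ p q) x =
      (∑ i, L₂ (EuclideanSpace.single i 1) ^ 2) * (q * (q - 1 : ℕ) *
        formMonomial L₁ L₂ p (q - 2) x) := by
  have key : ∀ v, fderiv ℝ (fun y => fderiv ℝ (formMonomial L₁ L₂ p q) y v) x v =
      L₁ v ^ 2 * (p * (p - 1 : ℕ) * formMonomial L₁ L₂ (p - 2) q x) +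
      L₁ v * L₂ v * (2 * p * q * formMonomial L₁ L₂ (p - 1) (q - 1) x) +
      L₂ v ^ 2 * (q * (q - 1 : ℕ) * formMonomial L₁ L₂ p (q - 2) x) := by
    intro v
    simp only [fderiv_formMonomial]
    have hd : ∀ p q, DifferentiableAt ℝ (formMonomial L₁ L₂ p q) x := fun p q =>
      (contDiff_formMonomial L₁ L₂ p q).differentiable (by norm_num) x
    rw [fderiv_fun_add ((hd _ _).const_mul _) ((hd _ _).const_mul _), add_apply,
      fderiv_const_mul_apply, fderiv_const_mul_apply, fderiv_formMonomial, fderiv_formMonomial]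
    simp only [Nat.sub_sub, Nat.reduceAdd]
    ring
  simp only [coordLaplacian, key, Finset.sum_add_distrib, ← Finset.sum_mul, h₁₁, h₁₂]
  ring

theorem coordLaplacian_normSq_pow_mul_formMonomial
    (h₁₁ : ∑ i, L₁ (EuclideanSpace.single i 1) ^ 2 = 0)
    (h₁₂ : ∑ i, L₁ (EuclideanSpace.single i 1) * L₂ (EuclideanSpace.single i 1) = 0)
    (h₂₂ : ∑ i, L₂ (EuclideanSpace.single i 1) ^ 2 = 1)
    (b p q : ℕ) (x : EuclideanSpace ℝ (Fin N)) :
    coordLaplacian (fun x => (((‖x‖ ^ 2) ^ b : ℝ) : ℂ) * formMonomial L₁ L₂ p q x) x =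
      2 * b * (2 * (b - 1) + N + 2 * (p + q)) *
        ((((‖x‖ ^ 2) ^ (b - 1) : ℝ) : ℂ) * formMonomial L₁ L₂ p q x) +
      q * (q - 1 : ℕ) * ((((‖x‖ ^ 2) ^ b : ℝ) : ℂ) * formMonomial L₁ L₂ p (q - 2) x) := by
  have hF : ∀ s : ℝ, HasDerivAt (fun s => s ^ b) (b * s ^ (b - 1)) s := fun s => hasDerivAt_pow b s
  have hF' : ∀ s : ℝ, HasDerivAt (fun s : ℝ => (b : ℝ) * s ^ (b - 1))
      (b * ((b - 1 : ℕ) * s ^ (b - 1 - 1))) s := fun s =>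
    (hasDerivAt_pow (b - 1) s).const_mul (b : ℝ)
  have hM := contDiff_formMonomial L₁ L₂ p q
  rw [coordLaplacian_radial_mul hF hF' hM, coordLaplacian_formMonomial L₁ L₂ h₁₁ h₁₂, h₂₂,
    fderiv_self_of_homogeneous (hM.differentiable (by norm_num) x)
      fun t _ => formMonomial_smul L₁ L₂ p q t x]
  rcases b with _ | _ | b
  · simp
  · simp
    ring
  · simp only [Nat.add_sub_cancel]
    push_cast
    ring

end

/-! ### The planar solid harmonics `(x + iy)^m` -/

/-- The complex linear form `x_i + c x_j`. -/
noncomputable def complexForm {N : ℕ} (i j : Fin N) (c : ℂ) : EuclideanSpace ℝ (Fin N) →L[ℝ] ℂ :=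
  Complex.ofRealCLM.comp (EuclideanSpace.proj i) +
    c • Complex.ofRealCLM.comp (EuclideanSpace.proj j)

theorem complexForm_apply {N : ℕ} (i j : Fin N) (c : ℂ) (x : EuclideanSpace ℝ (Fin N)) :
    complexForm i j c x = (x i : ℂ) + c * (x j : ℂ) := by
  simp [complexForm]

/-- The planar solid harmonic `(x + iy)^m`. -/
noncomputable def planarSolid (m : ℕ) : EuclideanSpace ℝ (Fin 2) → ℂ :=
  formMonomial (complexForm 0 1 Complex.I) 0 m 0

theorem isSolidHarmonic_planarSolid (m : ℕ) : IsSolidHarmonic m (planarSolid m) where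
  contDiff := contDiff_formMonomial _ _ m 0
  homogeneous t x _ := formMonomial_smul _ _ m 0 t x
  harmonic x := by
    rw [planarSolid, coordLaplacian_formMonomial]
    · simp
    · simp [Fin.sum_univ_two, complexForm_apply]
    · simp
  exists_ne_zero := ⟨EuclideanSpace.single 0 1, by
    simp [planarSolid, formMonomial, complexForm_apply]⟩

theorem planarMode_eq (m : ℕ) (κ : ℝ) (x : EuclideanSpace ℝ (Fin 2)) :
    planarMode m κ x = (((κ / 2) ^ m : ℝ) : ℂ) * radialMode m (planarSolid m) κ x := by
  have hn : ‖(⟨x 0, x 1⟩ : ℂ)‖ = ‖x‖ := by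
    rw [EuclideanSpace.norm_eq, Complex.norm_eq_sqrt_sq_add_sq]
    simp [Fin.sum_univ_two]
  have hz : (x 0 : ℂ) + Complex.I * (x 1 : ℂ) = (⟨x 0, x 1⟩ : ℂ) := by
    apply Complex.ext <;> simp
  have he := Complex.norm_mul_exp_arg_mul_I (⟨x 0, x 1⟩ : ℂ)
  rw [hn] at he
  rw [planarMode, radialMode, planarSolid, formMonomial, complexForm_apply, hz, ← he, besselJ_eq,
    Real.rpow_natCast, mul_pow, ← Complex.exp_nat_mul, besselEven]
  simp only [he]
  push_cast
  have e : Complex.I * (m : ℂ) * (Complex.arg ⟨x 0, x 1⟩ : ℂ) =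
      m * ((Complex.arg ⟨x 0, x 1⟩ : ℂ) * Complex.I) := by ring
  rw [e]
  ring


/-! ### The spatial solid harmonics -/

/-- The coefficient of `X^(2k-m-l)` in the `(m+l)`-th derivative of `(X² - 1)^m`. -/
def legendreCoeff (m l k : ℕ) : ℝ :=
  (m.choose k : ℝ) * (-1) ^ (m - k) * ((2 * k).descFactorial (m + l) : ℝ)

theorem legendreCoeff_eq_zero {m l k : ℕ} (h : 2 * k < m + l) : legendreCoeff m l k = 0 := by
  rw [legendreCoeff, Nat.descFactorial_eq_zero_iff_lt.2 h, Nat.cast_zero, mul_zero]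

theorem iterate_derivative_X_sq_sub_one_pow (m l : ℕ) :
    Polynomial.derivative^[m + l] ((Polynomial.X ^ 2 - 1 : Polynomial ℝ) ^ m) =
      ∑ k ∈ Finset.range (m + 1),
        Polynomial.C (legendreCoeff m l k) * Polynomial.X ^ (2 * k - (m + l)) := by
  rw [sub_eq_add_neg, add_pow, Polynomial.iterate_derivative_sum]
  refine Finset.sum_congr rfl fun k _ => ?_
  have e : ((Polynomial.X : Polynomial ℝ) ^ 2) ^ k * (-1) ^ (m - k) * (m.choose k : Polynomial ℝ) =
      Polynomial.C ((m.choose k : ℝ) * (-1) ^ (m - k)) * Polynomial.X ^ (2 * k) := by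
    simp only [map_mul, map_pow, map_neg, map_one, map_natCast, ← pow_mul]
    ring
  rw [e, Polynomial.iterate_derivative_C_mul, Polynomial.iterate_derivative_X_pow_eq_C_mul,
    legendreCoeff, ← mul_assoc, ← Polynomial.C_mul]

theorem assocLegendre_eq (m l : ℕ) (t : ℝ) :
    assocLegendre m l t = 1 / (2 ^ m * (m.factorial : ℝ)) * (√(1 - t ^ 2) ^ l *
      ∑ k ∈ Finset.range (m + 1), legendreCoeff m l k * t ^ (2 * k - (m + l))) := by
  rw [assocLegendre, legendreP, Polynomial.iterate_derivative_C_mul, ← Function.iterate_add_apply,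
    add_comm l m, iterate_derivative_X_sq_sub_one_pow]
  simp only [Polynomial.eval_mul, Polynomial.eval_C, Polynomial.eval_finsetSum, Polynomial.eval_pow,
    Polynomial.eval_X]
  ring

/-- The sum is a derivative of order `m + l ≤ 2m` of a monic polynomial of degree `2m`, hence a
nonzero polynomial with finitely many roots. -/
theorem exists_legendreCoeff_sum_ne_zero {m l : ℕ} (hl : l ≤ m) :
    ∃ t ∈ Set.Ioo (0 : ℝ) 1,
      ∑ k ∈ Finset.range (m + 1), legendreCoeff m l k * t ^ (2 * k - (m + l)) ≠ 0 := by
  set p := Polynomial.derivative^[m + l] ((Polynomial.X ^ 2 - 1 : Polynomial ℝ) ^ m) with hp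
  have hp0 : p ≠ 0 := by
    intro h
    have hm : ((Polynomial.X ^ 2 - 1 : Polynomial ℝ) ^ m).Monic :=
      (Polynomial.monic_X_pow_sub_C (1 : ℝ) two_ne_zero).pow m
    have hd : ((Polynomial.X ^ 2 - 1 : Polynomial ℝ) ^ m).natDegree = m - l + (m + l) := by
      have h2 : (Polynomial.X ^ 2 - 1 : Polynomial ℝ).natDegree = 2 :=
        Polynomial.natDegree_X_pow_sub_C (r := (1 : ℝ))
      rw [Polynomial.natDegree_pow, h2]
      omega
    have hc := Polynomial.coeff_iterate_derivative (k := m + l)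
      ((Polynomial.X ^ 2 - 1 : Polynomial ℝ) ^ m) (m - l)
    rw [← hp, h, ← hd, hm.coeff_natDegree, hd, Polynomial.coeff_zero, nsmul_one] at hc
    have := Nat.descFactorial_eq_zero_iff_lt.1 (Nat.cast_eq_zero.1 hc.symm)
    omega
  have hinf : (Set.Ioo (0 : ℝ) 1 \ {t | p.IsRoot t}).Nonempty :=
    ((Set.Ioo_infinite one_pos).sdiff (Polynomial.finite_setOfPred_isRoot hp0)).nonempty
  obtain ⟨t, ht, hr⟩ := hinf
  refine ⟨t, ht, fun h => hr ?_⟩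
  rw [Set.mem_ofPred_eq, Polynomial.IsRoot, hp, iterate_derivative_X_sq_sub_one_pow]
  simpa [Polynomial.eval_finsetSum] using h

/-- This is the cancellation between neighbouring terms in the Laplacian of `spatialSolid`. The
factor `2(m-k)(2k+1)` is `2b(2(b-1) + 3 + 2(p+q))` at `b = m-k`, `p = l`, `q = 2k-m-l`. -/
theorem legendreCoeff_recurrence {m l k : ℕ} (hk : k < m) (hl : m + l ≤ 2 * k) :
    legendreCoeff m l k * (2 * (m - k) * (2 * k + 1)) +
      legendreCoeff m l (k + 1) *
        ((2 * (k + 1) - (m + l) : ℕ) * (2 * (k + 1) - (m + l) - 1 : ℕ)) = 0 := by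
  obtain ⟨a, ha⟩ := Nat.exists_eq_add_of_le hl
  have e1 : 2 * (k + 1) - (m + l) = a + 2 := by omega
  have e2 : m - k = m - (k + 1) + 1 := by omega
  have hd1 := Nat.factorial_mul_descFactorial hl
  have hd2 := Nat.factorial_mul_descFactorial (show m + l ≤ 2 * (k + 1) by omega)
  have hch := Nat.choose_succ_right_eq m k
  rw [show 2 * k - (m + l) = a by omega] at hd1
  rw [e1, show 2 * (k + 1) = 2 * k + 1 + 1 by ring, Nat.factorial_succ (a + 1),
    Nat.factorial_succ a, Nat.factorial_succ (2 * k + 1), Nat.factorial_succ (2 * k),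
    ← hd1] at hd2
  rw [show 2 * k + 1 + 1 = 2 * (k + 1) by ring] at hd2
  have hd2' : ((a : ℝ) + 2) * (a + 1) * ((2 * (k + 1)).descFactorial (m + l) : ℝ) =
      (2 * k + 2) * (2 * k + 1) * ((2 * k).descFactorial (m + l) : ℝ) := by
    have hf : (a.factorial : ℝ) ≠ 0 := by positivity
    have := congrArg (fun n : ℕ => (n : ℝ)) hd2
    push_cast at this
    apply mul_left_cancel₀ hf
    linear_combination this
  have hch' : (m.choose (k + 1) : ℝ) * (k + 1) = m.choose k * (m - k) := by
    have := congrArg (fun n : ℕ => (n : ℝ)) hch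
    push_cast [Nat.cast_sub hk.le] at this
    exact this
  rw [legendreCoeff, legendreCoeff, e1, e2, pow_succ]
  push_cast
  linear_combination ((m.choose (k + 1) : ℝ)) * (-1) ^ (m - (k + 1)) * hd2' +
    2 * (2 * k + 1) * (-1) ^ (m - (k + 1)) * ((2 * k).descFactorial (m + l) : ℝ) * hch'

/-- The spatial solid harmonic `(x ± iy)^l ∑_k c_k z^(2k-m-l) |x|^(2(m-k))`; the sign is that of
`ε = ±1`. -/
noncomputable def spatialSolid (m l : ℕ) (ε : ℝ) (x : EuclideanSpace ℝ (Fin 3)) : ℂ :=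
  ∑ k ∈ Finset.range (m + 1), (legendreCoeff m l k : ℂ) * ((((‖x‖ ^ 2) ^ (m - k) : ℝ) : ℂ) *
    formMonomial (complexForm 0 1 (Complex.I * ε)) (complexForm 2 2 0) l (2 * k - (m + l)) x)

theorem contDiff_spatialSolid_term (m l k : ℕ) (ε : ℝ) :
    ContDiff ℝ 2 fun x : EuclideanSpace ℝ (Fin 3) => (((‖x‖ ^ 2) ^ (m - k) : ℝ) : ℂ) *
      formMonomial (complexForm 0 1 (Complex.I * ε)) (complexForm 2 2 0) l (2 * k - (m + l)) x :=
  (Complex.ofRealCLM.contDiff.comp ((contDiff_norm_sq ℝ).pow (m - k))).mul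
    (contDiff_formMonomial _ _ _ _)

theorem coordLaplacian_spatialSolid {m l : ℕ} {ε : ℝ} (hε : ε ^ 2 = 1)
    (x : EuclideanSpace ℝ (Fin 3)) : coordLaplacian (spatialSolid m l ε) x = 0 := by
  have hεC : (ε : ℂ) ^ 2 = 1 := by exact_mod_cast hε
  unfold spatialSolid
  rw [coordLaplacian_sum _ fun k => contDiff_const.mul (contDiff_spatialSolid_term m l k ε)]
  simp only [coordLaplacian_const_mul]
  have hlap : ∀ b q, _ := fun b q => coordLaplacian_normSq_pow_mul_formMonomial
    (complexForm (N := 3) 0 1 (Complex.I * ε)) (complexForm 2 2 0)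
    (by simp [Fin.sum_univ_three, complexForm_apply, mul_pow, hεC])
    (by simp [Fin.sum_univ_three, complexForm_apply])
    (by simp [Fin.sum_univ_three, complexForm_apply]) b l q x
  simp only [hlap]
  simp only [mul_add, Finset.sum_add_distrib]
  -- Differentiating `|x|^(2b)` in term `k` is paired with differentiating the power of `z` in term
  -- `k + 1`. The unpaired ends vanish: `b = 0` at `k = m`, and the truncated exponent of `z` is `0`
  -- at `k = 0`.
  rw [Finset.sum_range_succ, Finset.sum_range_succ' _ m]
  have z1 : ((m - m : ℕ) : ℂ) = 0 := by simp
  have z2 : ((0 - (m + l) : ℕ) : ℂ) = 0 := by simp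
  simp only [z1, z2, mul_zero, zero_mul, add_zero]
  rw [← Finset.sum_add_distrib]
  refine Finset.sum_eq_zero fun k hk => ?_
  have hkm : k < m := Finset.mem_range.1 hk
  by_cases hl : m + l ≤ 2 * k
  · have hr := congrArg (fun t : ℝ => (t : ℂ)) (legendreCoeff_recurrence hkm hl)
    have eq1 : 2 * (k + 1) - (m + l) - 2 = 2 * k - (m + l) := by omega
    have eq2 : m - (k + 1) = m - k - 1 := by omega
    have eq3 : ((2 * k - (m + l) : ℕ) : ℂ) = 2 * k - (m + l) := by
      rw [Nat.cast_sub hl]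
      push_cast
      ring
    have eq4 : ((m - k : ℕ) : ℂ) = m - k := by rw [Nat.cast_sub hkm.le]
    rw [eq1, eq2, eq3, eq4]
    push_cast at hr ⊢
    generalize formMonomial (complexForm (N := 3) 0 1 (Complex.I * ε)) (complexForm 2 2 0) l
      (2 * k - (m + l)) x = M
    linear_combination ((‖x‖ : ℂ) ^ 2) ^ (m - k - 1) * M * hr
  -- Here the exponent of `z` in term `k + 1` is `0` or `1`, so its second derivative vanishes,
  -- while the coefficient of term `k` is `0`.
  · have hz : ((2 * (k + 1) - (m + l) : ℕ) : ℂ) * ((2 * (k + 1) - (m + l) - 1 : ℕ) : ℂ) = 0 := by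
      have : 2 * (k + 1) - (m + l) = 0 ∨ 2 * (k + 1) - (m + l) - 1 = 0 := by omega
      rcases this with h | h <;> simp [h]
    rw [hz, legendreCoeff_eq_zero (not_le.1 hl)]
    simp

theorem isSolidHarmonic_spatialSolid {m l : ℕ} (hl : l ≤ m) {ε : ℝ} (hε : ε ^ 2 = 1) :
    IsSolidHarmonic m (spatialSolid m l ε) where
  contDiff := ContDiff.sum fun k _ => contDiff_const.mul (contDiff_spatialSolid_term m l k ε)
  homogeneous t x ht := by
    simp only [spatialSolid, Finset.mul_sum]
    refine Finset.sum_congr rfl fun k hk => ?_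
    by_cases h : m + l ≤ 2 * k
    · rw [formMonomial_smul, norm_smul, Real.norm_of_nonneg ht.le]
      have hk := Finset.mem_range.1 hk
      have e : (t : ℂ) ^ m = ((t : ℂ) ^ 2) ^ (m - k) * (t : ℂ) ^ (l + (2 * k - (m + l))) := by
        rw [← pow_mul, ← pow_add]
        congr 1
        omega
      rw [e]
      push_cast
      ring
    · simp [legendreCoeff_eq_zero (not_le.1 h)]
  harmonic := coordLaplacian_spatialSolid hε
  exists_ne_zero := by
    obtain ⟨t, ⟨ht0, ht1⟩, ht⟩ := exists_legendreCoeff_sum_ne_zero hl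
    have hs : 0 < 1 - t ^ 2 := by nlinarith
    refine ⟨!₂[√(1 - t ^ 2), 0, t], ?_⟩
    have hn : ‖(!₂[√(1 - t ^ 2), 0, t] : EuclideanSpace ℝ (Fin 3))‖ ^ 2 = 1 := by
      rw [EuclideanSpace.norm_sq_eq]
      simp [Fin.sum_univ_three, Real.sq_sqrt hs.le]
    have e : spatialSolid m l ε !₂[√(1 - t ^ 2), 0, t] = (((√(1 - t ^ 2)) ^ l *
        ∑ k ∈ Finset.range (m + 1), legendreCoeff m l k * t ^ (2 * k - (m + l)) : ℝ) : ℂ) := by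
      simp only [spatialSolid, hn, one_pow, formMonomial, complexForm_apply]
      push_cast
      rw [Finset.mul_sum]
      refine Finset.sum_congr rfl fun k _ => ?_
      simp
      ring
    rw [e]
    exact_mod_cast mul_ne_zero (pow_ne_zero _ (Real.sqrt_pos.2 hs).ne') ht

theorem spatialSolid_eq {m l : ℕ} (hl : l ≤ m) (ε : ℝ) (hε : ε = 1 ∨ ε = -1)
    (x : EuclideanSpace ℝ (Fin 3)) :
    ((‖x‖ ^ m * (√(1 - (x 2 / ‖x‖) ^ 2) ^ l * ∑ k ∈ Finset.range (m + 1),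
      legendreCoeff m l k * (x 2 / ‖x‖) ^ (2 * k - (m + l))) : ℝ) : ℂ) *
      Complex.exp (Complex.I * (ε * l) * (Complex.arg ⟨x 0, x 1⟩ : ℂ)) = spatialSolid m l ε x := by
  by_cases hx : x = 0
  · subst hx
    rcases Nat.eq_zero_or_pos m with rfl | hm
    · obtain rfl : l = 0 := Nat.le_zero.1 hl
      simp [spatialSolid, formMonomial]
    · have hε2 : ε ^ 2 = 1 := by rcases hε with rfl | rfl <;> norm_num
      -- Homogeneity of positive degree at the origin forces the value `0` there.
      have h := (isSolidHarmonic_spatialSolid hl hε2).homogeneous 2 0 two_pos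
      rw [smul_zero] at h
      have h2 : ((2 : ℝ) : ℂ) ^ m ≠ 1 := by
        have : (2 : ℝ) ^ m ≠ 1 := (one_lt_pow₀ one_lt_two hm.ne').ne'
        exact_mod_cast this
      have h3 : spatialSolid m l ε 0 = 0 := by
        have : (((2 : ℝ) : ℂ) ^ m - 1) * spatialSolid m l ε 0 = 0 := by linear_combination -h
        exact (mul_eq_zero.1 this).resolve_left (sub_ne_zero.2 h2)
      simp [h3, hm.ne']
  have hr : 0 < ‖x‖ := norm_pos_iff.2 hx
  have hsq : ‖x‖ ^ 2 = x 0 ^ 2 + x 1 ^ 2 + x 2 ^ 2 := by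
    rw [EuclideanSpace.norm_sq_eq]
    simp [Fin.sum_univ_three]
  have hρ : √(1 - (x 2 / ‖x‖) ^ 2) * ‖x‖ = ‖(⟨x 0, x 1⟩ : ℂ)‖ := by
    rw [Complex.norm_eq_sqrt_sq_add_sq]
    nth_rewrite 2 [← Real.sqrt_sq hr.le]
    rw [← Real.sqrt_mul' _ (by positivity)]
    congr 1
    field_simp
    linarith
  -- This is `r sin θ e^{±iφ} = x ± iy`; the lower sign follows by complex conjugation.
  have hζ : ((√(1 - (x 2 / ‖x‖) ^ 2) * ‖x‖ : ℝ) : ℂ) *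
      Complex.exp (Complex.I * ε * (Complex.arg ⟨x 0, x 1⟩ : ℂ)) =
      (x 0 : ℂ) + Complex.I * ε * (x 1 : ℂ) := by
    rw [hρ]
    have h := Complex.norm_mul_exp_arg_mul_I (⟨x 0, x 1⟩ : ℂ)
    rcases hε with rfl | rfl
    · have e : Complex.I * ((1 : ℝ) : ℂ) * (Complex.arg ⟨x 0, x 1⟩ : ℂ) =
          (Complex.arg ⟨x 0, x 1⟩ : ℂ) * Complex.I := by push_cast; ring
      rw [e, h]
      apply Complex.ext <;> simp
    · have h' := congrArg (starRingEnd ℂ) h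
      rw [map_mul, Complex.conj_ofReal, ← Complex.exp_conj, map_mul, Complex.conj_ofReal,
        Complex.conj_I] at h'
      have e : Complex.I * ((-1 : ℝ) : ℂ) * (Complex.arg ⟨x 0, x 1⟩ : ℂ) =
          (Complex.arg ⟨x 0, x 1⟩ : ℂ) * -Complex.I := by push_cast; ring
      rw [e, h']
      apply Complex.ext <;> simp
  have hexp : Complex.exp (Complex.I * (ε * l) * (Complex.arg ⟨x 0, x 1⟩ : ℂ)) =
      Complex.exp (Complex.I * ε * (Complex.arg ⟨x 0, x 1⟩ : ℂ)) ^ l := by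
    rw [← Complex.exp_nat_mul]
    congr 1
    ring
  rw [hexp, spatialSolid]
  simp only [formMonomial, complexForm_apply, ← hζ, Finset.mul_sum, Complex.ofReal_sum,
    Finset.sum_mul]
  generalize √(1 - (x 2 / ‖x‖) ^ 2) = w
  refine Finset.sum_congr rfl fun k hk => ?_
  by_cases h : m + l ≤ 2 * k
  · have hk := Finset.mem_range.1 hk
    have e : (‖x‖ : ℂ) ^ m =
        ((‖x‖ : ℂ) ^ 2) ^ (m - k) * ((‖x‖ : ℂ) ^ l * (‖x‖ : ℂ) ^ (2 * k - (m + l))) := by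
      rw [← pow_mul, ← pow_add, ← pow_add]
      congr 1
      omega
    have hrC : (‖x‖ : ℂ) ≠ 0 := by exact_mod_cast hr.ne'
    push_cast
    rw [e, div_pow, mul_pow, mul_pow, zero_mul, add_zero]
    field_simp
  · simp [legendreCoeff_eq_zero (not_le.1 h)]

/-- The constant relating `spatialMode` to the radial mode of the solid harmonic. -/
noncomputable def spatialConst (m l : ℕ) : ℝ :=
  √Real.pi / 2 * √((2 * (m : ℝ) + 1) / (4 * Real.pi) *
    (((m - l).factorial : ℝ) / ((m + l).factorial : ℝ))) * (1 / (2 ^ m * (m.factorial : ℝ)))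

theorem spatialConst_pos (m l : ℕ) : 0 < spatialConst m l := by
  have := Real.pi_pos
  have h1 : 0 < √((2 * (m : ℝ) + 1) / (4 * Real.pi) *
      (((m - l).factorial : ℝ) / ((m + l).factorial : ℝ))) := Real.sqrt_pos.2 (by positivity)
  unfold spatialConst
  positivity

/-- The sign of an integer, with value `1` at zero. -/
noncomputable def orderSign (l : ℤ) : ℝ := if 0 ≤ l then 1 else -1

theorem orderSign_eq_or (l : ℤ) : orderSign l = 1 ∨ orderSign l = -1 := by
  unfold orderSign
  split_ifs <;> simp

theorem orderSign_sq (l : ℤ) : orderSign l ^ 2 = 1 := by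
  rcases orderSign_eq_or l with h | h <;> simp [h]

theorem orderSign_mul_natAbs (l : ℤ) : (orderSign l : ℂ) * (l.natAbs : ℂ) = l := by
  unfold orderSign
  have h1 : ((l.natAbs : ℕ) : ℂ) = ((|l| : ℤ) : ℂ) := by
    rw [← Int.natCast_natAbs l]
    simp
  rw [h1]
  split_ifs with h
  · rw [abs_of_nonneg h]
    simp
  · rw [abs_of_neg (not_le.1 h)]
    simp

theorem spatialMode_eq {m : ℕ} {l : ℤ} (hl : l.natAbs ≤ m) (κ : ℝ)
    (x : EuclideanSpace ℝ (Fin 3)) :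
    spatialMode m l κ x = ((spatialConst m l.natAbs * (κ / 2) ^ m : ℝ) : ℂ) *
      radialMode (m + 1 / 2) (spatialSolid m l.natAbs (orderSign l)) κ x := by
  have hcos : Real.cos (Real.arccos (x 2 / ‖x‖)) = x 2 / ‖x‖ := by
    have h : |x 2 / ‖x‖| ≤ 1 := by
      rw [abs_div, abs_norm]
      exact div_le_one_of_le₀ (PiLp.norm_apply_le x 2) (norm_nonneg x)
    exact Real.cos_arccos (abs_le.1 h).1 (abs_le.1 h).2
  rw [radialMode, ← spatialSolid_eq hl _ (orderSign_eq_or l), spatialMode,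
    sphericalBesselJ_eq_series, sphericalY, hcos, assocLegendre_eq, orderSign_mul_natAbs,
    spatialConst, besselEven]
  generalize √(1 - (x 2 / ‖x‖) ^ 2) ^ l.natAbs * ∑ k ∈ Finset.range (m + 1),
    legendreCoeff m l.natAbs k * (x 2 / ‖x‖) ^ (2 * k - (m + l.natAbs)) = S
  push_cast
  ring


/-! ### The transmission eigenmodes -/

/-- The refractive indices and amplitude ratios `ρ` for which the radial modes of a family of
solid harmonics are transmission eigenfunctions; both families of modes are surface-localized. -/
theorem exists_transmission_indices {N : ℕ} [NeZero N] {k r₀ : ℝ} (hk : 0 < k) (hr₀ : 0 < r₀)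
    {s₀ : ℕ} (hs₀ : 1 ≤ s₀) {σ : ℕ → ℝ} (hσ : ∀ m, 0 < σ m) {a : ℝ} (ha : 0 ≤ a)
    (haN : a + 1 = N / 2) :
    ∃ τ n : ℕ → ℝ, (∀ m, 0 < τ m) ∧ (∀ m, 0 < n m) ∧ (∀ m, n m = √(τ m / σ m)) ∧
      (∀ m : ℕ, n m ∈ Set.Ioo (besselZero (m + a) s₀ / (k * r₀))
        (besselZero (m + a) (s₀ + 1) / (k * r₀))) ∧
      (∀ m : ℕ, ∃ ρ : ℂ, ρ ≠ 0 ∧ (besselJ (m + a) (k * r₀) ≠ 0 →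
        ∀ H : EuclideanSpace ℝ (Fin N) → ℂ, IsSolidHarmonic m H → ∀ β : ℂ, β ≠ 0 →
          IsTransmissionEigenpair r₀ (fun _ => σ m) (fun _ => τ m) k
            (fun x => β * radialMode (m + a) H k x)
            (fun x => ρ * β * radialMode (m + a) H (k * n m) x))) ∧
      ∀ H : ℕ → EuclideanSpace ℝ (Fin N) → ℂ, (∀ m, IsSolidHarmonic m (H m)) →
        ∀ γ : ℕ → ℂ, (∀ m, γ m ≠ 0) →
          SurfaceLocalized (ball 0 r₀) (fun m x => γ m * radialMode (m + a) (H m) k x) ∧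
          SurfaceLocalized (ball 0 r₀) (fun m x => γ m * radialMode (m + a) (H m) (k * n m) x) := by
  obtain ⟨s, rfl⟩ := Nat.exists_eq_add_of_le' hs₀
  have hR : 0 < k * r₀ := mul_pos hk hr₀
  have hν : ∀ m : ℕ, 0 ≤ (m : ℝ) + a := fun m => by positivity
  choose z hz hroot using fun m : ℕ => exists_transmission_root (hν m) s m (hσ m) (k * r₀)
  have hz0 : ∀ m, 0 < z m := fun m => (besselZero_succ_pos (hν m) s).trans (hz m).1
  set n : ℕ → ℝ := fun m => z m / (k * r₀) with hn
  have hn0 : ∀ m, 0 < n m := fun m => div_pos (hz0 m) hR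
  have hzn : ∀ m, k * n m * r₀ = z m := fun m => by
    simp only [hn]
    field_simp
  have hlim : Tendsto (fun m : ℕ => (m : ℝ) + a) atTop atTop :=
    tendsto_atTop_add_const_right _ _ tendsto_natCast_atTop_atTop
  refine ⟨fun m => σ m * n m ^ 2, n, fun m => mul_pos (hσ m) (pow_pos (hn0 m) 2), hn0,
    fun m => ?_, fun m => ?_, fun m => ?_, fun H hH γ hγ => ⟨?_, ?_⟩⟩
  · rw [mul_div_cancel_left₀ _ (hσ m).ne', Real.sqrt_sq (hn0 m).le]
  · exact ⟨div_lt_div_of_pos_right (hz m).1 hR, div_lt_div_of_pos_right (hz m).2 hR⟩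
  · have hzne : besselEven (m + a) (z m) ≠ 0 := besselEven_ne_zero_between (hν m) (s + 1) _ (hz m)
    by_cases hJ : besselEven (m + a) (k * r₀) = 0
    · exact ⟨1, one_ne_zero, fun h => absurd ((besselJ_eq_zero_iff hR).2 hJ) h⟩
    have hzC : (besselEven (m + a) (z m) : ℂ) ≠ 0 := by exact_mod_cast hzne
    have hJC : (besselEven (m + a) (k * r₀) : ℂ) ≠ 0 := by exact_mod_cast hJ
    -- This ratio is dictated by the Dirichlet condition; the Neumann condition is then the scalar
    -- equation solved by `z m`. Neither depends on `H`, so one index serves every `l`.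
    refine ⟨besselEven (m + a) (k * r₀) / besselEven (m + a) (z m), div_ne_zero hJC hzC,
      fun _ H hH β hβ => ?_⟩
    refine isTransmissionEigenpair_radialMode (hν m) hH (by linarith) hr₀ hβ ?_ ?_
    · rw [hzn]
      field_simp
    · rw [hzn]
      have h := congrArg (fun t : ℝ => (t : ℂ)) (hroot m hJ)
      push_cast at h ⊢
      field_simp
      linear_combination 2 * h
  · refine surfaceLocalized_radialMode hr₀ hν (fun _ => rfl) hH (fun _ => hk.le) (fun δ hδ => ?_) hγ
    filter_upwards [hlim.eventually_ge_atTop (k * r₀)] with m hm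
    nlinarith [hν m]
  · refine surfaceLocalized_radialMode hr₀ hν (fun _ => rfl) hH
      (fun m => (mul_pos hk (hn0 m)).le) (fun δ hδ => ?_) hγ
    filter_upwards [hlim.eventually (eventually_besselZero_le (s + 2) hδ)] with m hm
    rw [hzn]
    exact (hz m).2.le.trans hm

end TransmissionModes

/-! ### The two- and three-dimensional cases. -/

theorem lemma2p2 (k r₀ : ℝ) (hk : 0 < k) (hr₀ : 0 < r₀) (s₀ : ℕ) (hs₀ : 1 ≤ s₀)
    (σ : ℕ → ℝ) (hσ : ∀ m, 0 < σ m) :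
    -- the plane
    ((∀ m : ℕ, k * r₀ ≤ (m : ℝ) → TransmissionModes.besselJ (m : ℝ) (k * r₀) ≠ 0) ∧
      ∃ τ n : ℕ → ℝ, (∀ m, 0 < τ m) ∧ (∀ m, n m = √(τ m / σ m)) ∧
        (∀ m : ℕ, TransmissionModes.besselJ (m : ℝ) (k * r₀) ≠ 0 →
          n m ∈ Set.Ioo (TransmissionModes.besselZero (m : ℝ) s₀ / (k * r₀))
            (TransmissionModes.besselZero (m : ℝ) (s₀ + 1) / (k * r₀)) ∧
          TransmissionModes.IsTransmissionEigenvalue (N := 2) r₀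
            (fun _ => σ m) (fun _ => τ m) k) ∧
        ∀ β : ℕ → ℂ, (∀ m, β m ≠ 0) →
          ∃ α : ℕ → ℂ, (∀ m, α m ≠ 0) ∧
            (∀ m : ℕ, TransmissionModes.besselJ (m : ℝ) (k * r₀) ≠ 0 →
              TransmissionModes.IsTransmissionEigenpair r₀ (fun _ => σ m) (fun _ => τ m) k
                (fun x => β m * TransmissionModes.planarMode m k x)
                (fun x => α m * TransmissionModes.planarMode m (k * n m) x)) ∧
            TransmissionModes.SurfaceLocalized (Metric.ball 0 r₀)
              (fun m x => β m * TransmissionModes.planarMode m k x) ∧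
            TransmissionModes.SurfaceLocalized (Metric.ball 0 r₀)
              (fun m x => α m * TransmissionModes.planarMode m (k * n m) x)) ∧
    -- the three-dimensional space
    ((∀ m : ℕ, k * r₀ ≤ (m : ℝ) + 1 / 2 →
        TransmissionModes.besselJ ((m : ℝ) + 1 / 2) (k * r₀) ≠ 0) ∧
      ∃ τ n : ℕ → ℝ, (∀ m, 0 < τ m) ∧ (∀ m, n m = √(τ m / σ m)) ∧
        (∀ m : ℕ, TransmissionModes.besselJ ((m : ℝ) + 1 / 2) (k * r₀) ≠ 0 →
          n m ∈ Set.Ioo (TransmissionModes.besselZero ((m : ℝ) + 1 / 2) s₀ / (k * r₀))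
            (TransmissionModes.besselZero ((m : ℝ) + 1 / 2) (s₀ + 1) / (k * r₀)) ∧
          TransmissionModes.IsTransmissionEigenvalue (N := 3) r₀
            (fun _ => σ m) (fun _ => τ m) k) ∧
        ∀ β : ℕ → ℤ → ℂ, (∀ m l, β m l ≠ 0) →
          ∃ α : ℕ → ℤ → ℂ, (∀ m l, α m l ≠ 0) ∧
            (∀ (m : ℕ) (l : ℤ), |l| ≤ (m : ℤ) →
              TransmissionModes.besselJ ((m : ℝ) + 1 / 2) (k * r₀) ≠ 0 →
              TransmissionModes.IsTransmissionEigenpair r₀ (fun _ => σ m) (fun _ => τ m) k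
                (fun x => β m l * TransmissionModes.spatialMode m l k x)
                (fun x => α m l * TransmissionModes.spatialMode m l (k * n m) x)) ∧
            ∀ l : ℕ → ℤ, (∀ m, |l m| ≤ (m : ℤ)) →
              TransmissionModes.SurfaceLocalized (Metric.ball 0 r₀)
                (fun m x => β m (l m) * TransmissionModes.spatialMode m (l m) k x) ∧
              TransmissionModes.SurfaceLocalized (Metric.ball 0 r₀)
                (fun m x => α m (l m) * TransmissionModes.spatialMode m (l m) (k * n m) x)) := by
  have hR : 0 < k * r₀ := mul_pos hk hr₀
  refine ⟨⟨fun m hm => TransmissionModes.besselJ_ne_zero_of_le_order hR hm, ?_⟩,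
    ⟨fun m hm => TransmissionModes.besselJ_ne_zero_of_le_order hR hm, ?_⟩⟩
  · obtain ⟨τ, n, hτ, hn0, hn, hmem, hpair, hloc⟩ := TransmissionModes.exists_transmission_indices
      (N := 2) hk hr₀ hs₀ hσ (a := 0) le_rfl (by norm_num)
    simp only [add_zero] at hmem hpair hloc
    choose ρ hρ0 hρ using hpair
    have hc : ∀ κ : ℝ, 0 < κ → ∀ m : ℕ, (((κ / 2) ^ m : ℝ) : ℂ) ≠ 0 := fun κ hκ m => by
      exact_mod_cast (pow_pos (half_pos hκ) m).ne'
    have hkn : ∀ m, 0 < k * n m := fun m => mul_pos hk (hn0 m)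
    have hs := TransmissionModes.isSolidHarmonic_planarSolid
    refine ⟨τ, n, hτ, hn, fun m hm => ⟨hmem m, _, _, hρ m hm _ (hs m) 1 one_ne_zero⟩,
      fun β hβ => ?_⟩
    -- The quotient of powers compensates for the different constants relating the modes at
    -- wavenumbers `k` and `k n_m` to radial modes.
    set α : ℕ → ℂ := fun m =>
      ρ m * (β m * (((k / 2) ^ m : ℝ) : ℂ)) / (((k * n m / 2) ^ m : ℝ) : ℂ) with hα
    have hα0 : ∀ m, α m ≠ 0 := fun m =>
      div_ne_zero (mul_ne_zero (hρ0 m) (mul_ne_zero (hβ m) (hc k hk m))) (hc _ (hkn m) m)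
    have hv : ∀ m x, β m * TransmissionModes.planarMode m k x =
        β m * (((k / 2) ^ m : ℝ) : ℂ) *
          TransmissionModes.radialMode m (TransmissionModes.planarSolid m) k x := fun m x => by
      rw [TransmissionModes.planarMode_eq, mul_assoc]
    have hw : ∀ m x, α m * TransmissionModes.planarMode m (k * n m) x =
        ρ m * (β m * (((k / 2) ^ m : ℝ) : ℂ)) *
          TransmissionModes.radialMode m (TransmissionModes.planarSolid m) (k * n m) x :=
      fun m x => by
        rw [TransmissionModes.planarMode_eq, hα, ← mul_assoc, div_mul_cancel₀ _ (hc _ (hkn m) m)]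
    refine ⟨α, hα0, fun m hm => ?_, ?_, ?_⟩
    · simp only [hv, hw]
      exact hρ m hm _ (hs m) _ (mul_ne_zero (hβ m) (hc k hk m))
    · simp only [hv]
      exact (hloc _ hs _ fun m => mul_ne_zero (hβ m) (hc k hk m)).1
    · simp only [hw]
      exact (hloc _ hs _ fun m => mul_ne_zero (hρ0 m) (mul_ne_zero (hβ m) (hc k hk m))).2
  · obtain ⟨τ, n, hτ, hn0, hn, hmem, hpair, hloc⟩ := TransmissionModes.exists_transmission_indices
      (N := 3) hk hr₀ hs₀ hσ (a := 1 / 2) (by norm_num) (by norm_num)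
    choose ρ hρ0 hρ using hpair
    set c : ℝ → ℕ → ℤ → ℂ := fun κ m l =>
      ((TransmissionModes.spatialConst m l.natAbs * (κ / 2) ^ m : ℝ) : ℂ)
    have hc : ∀ κ : ℝ, 0 < κ → ∀ m l, c κ m l ≠ 0 := fun κ hκ m l =>
      Complex.ofReal_ne_zero.2 (mul_pos (TransmissionModes.spatialConst_pos m l.natAbs)
        (pow_pos (half_pos hκ) m)).ne'
    have hkn : ∀ m, 0 < k * n m := fun m => mul_pos hk (hn0 m)
    have habs : ∀ (m : ℕ) (l : ℤ), |l| ≤ (m : ℤ) → l.natAbs ≤ m := fun m l h => by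
      rwa [Int.abs_eq_natAbs, Nat.cast_le] at h
    set S : ℕ → ℤ → EuclideanSpace ℝ (Fin 3) → ℂ := fun m l =>
      TransmissionModes.spatialSolid m l.natAbs (TransmissionModes.orderSign l)
    have hs : ∀ (m : ℕ) (l : ℤ), |l| ≤ (m : ℤ) → TransmissionModes.IsSolidHarmonic m (S m l) :=
      fun m l h => TransmissionModes.isSolidHarmonic_spatialSolid (habs m l h)
        (TransmissionModes.orderSign_sq l)
    refine ⟨τ, n, hτ, hn, fun m hm => ⟨hmem m, _, _,
      hρ m hm _ (hs m 0 (by simp)) 1 one_ne_zero⟩, fun β hβ => ?_⟩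
    set α : ℕ → ℤ → ℂ := fun m l => ρ m * (β m l * c k m l) / c (k * n m) m l with hα
    have hα0 : ∀ m l, α m l ≠ 0 := fun m l =>
      div_ne_zero (mul_ne_zero (hρ0 m) (mul_ne_zero (hβ m l) (hc k hk m l))) (hc _ (hkn m) m l)
    have hv : ∀ (m : ℕ) (l : ℤ), |l| ≤ (m : ℤ) → ∀ x,
        β m l * TransmissionModes.spatialMode m l k x =
          β m l * c k m l * TransmissionModes.radialMode (m + 1 / 2) (S m l) k x :=
      fun m l h x => by
        rw [TransmissionModes.spatialMode_eq (habs m l h), mul_assoc]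
    have hw : ∀ (m : ℕ) (l : ℤ), |l| ≤ (m : ℤ) → ∀ x,
        α m l * TransmissionModes.spatialMode m l (k * n m) x =
          ρ m * (β m l * c k m l) *
            TransmissionModes.radialMode (m + 1 / 2) (S m l) (k * n m) x :=
      fun m l h x => by
        rw [TransmissionModes.spatialMode_eq (habs m l h), hα, ← mul_assoc,
          div_mul_cancel₀ _ (hc _ (hkn m) m l)]
    refine ⟨α, hα0, fun m l hl hm => ?_, fun l hl => ⟨?_, ?_⟩⟩
    · simp only [hv m l hl, hw m l hl]
      exact hρ m hm _ (hs m l hl) _ (mul_ne_zero (hβ m l) (hc k hk m l))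
    · simp only [hv _ _ (hl _)]
      exact (hloc _ (fun m => hs m (l m) (hl m)) _ fun m =>
        mul_ne_zero (hβ m (l m)) (hc k hk m (l m))).1
    · simp only [hw _ _ (hl _)]
      exact (hloc _ (fun m => hs m (l m) (hl m)) _ fun m =>
        mul_ne_zero (hρ0 m) (mul_ne_zero (hβ m (l m)) (hc k hk m (l m)))).2
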